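/- Let $(M,\omega)$ be a four-dimensional symplectic manifold and let $\rho_1\neq\rho_2$ be two commuting antisymplectic involutions of $M$, i.e. smooth maps with $\rho_i^2=\mathrm{id}$, $\rho_i^*\omega=-\omega$ and $\rho_1\rho_2=\rho_2\rho_1$. Let $H\colon M\to\mathbb{R}$ be smooth with $H\circ\rho_1=H=H\circ\rho_2$, let $X_H$ be its Hamiltonian vector field, defined by $dH=\omega(\cdot,X_H)$, and let $\phi_H^t$ be the (possibly only partially defined) flow of $X_H$. A periodic orbit of period $\tau>0$ is a nonconstant map $v\colon\mathbb{R}/\mathbb{Z}\to M$ with $\partial_t v=\tau X_H(v)$; it is simple if $v$ is injective. A simple periodic orbit $v$ is called doubly symmetric if $\rho_1(v(-t))=v(t)$ for all $t$ and $\rho_2(v(0))=v(\tfrac12)$. The reduced monodromy of a periodic orbit $v$ of period $\tau$ is the endomorphism $M_v$ of the plane $\ker dH(v(0))/\langle X_H(v(0))\rangle$ induced by $d\phi_H^\tau(v(0))$, and $v$ is negative hyperbolic if $\mathrm{tr}(M_v)<-2$. For an integer $k\ge 1$ the $k$-fold cover of $v$ is the periodic orbit $t\mapsto v(kt)$ of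 period $k\tau$. A periodic orbit is bad if it is the $k$-fold cover of a negative hyperbolic periodic orbit for some even $k\geq 2$, and good otherwise. Let $v$ be a doubly symmetric periodic orbit. Then the reduced monodromy of $v$ is well defined, $v$ is not negative hyperbolic, and for every $k\ge1$ the $k$-fold cover of $v$ is a good periodic orbit. -/

import Mathlib

open scoped Manifold ContDiff Topology
open Set

noncomputable section

/-- The model space `ℝ⁴` of a four-dimensional manifold. -/
abbrev R4 : Type := EuclideanSpace ℝ (Fin 4)

section Symplectic

variable {M : Type*} [TopologicalSpace M] [ChartedSpace R4 M]

/-- The expression of a field of alternating 2-forms `Ω` on `M` in the chart around `x₀`: the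
pullback of `Ω` under the inverse of the chart, a field of alternating 2-forms on `ℝ⁴`
(only its values on the target of the chart matter). -/
def chartForm (Ω : ∀ x : M, (TangentSpace (𝓡 4) x) [⋀^Fin 2]→L[ℝ] ℝ) (x₀ : M) (y : R4) :
    R4 [⋀^Fin 2]→L[ℝ] ℝ :=
  (Ω ((extChartAt (𝓡 4) x₀).symm y)).compContinuousLinearMap
    (mfderiv 𝓘(ℝ, R4) (𝓡 4) (extChartAt (𝓡 4) x₀).symm y)

variable (M) in
/-- A symplectic form on a four-dimensional manifold without boundary: a smooth, closed and
nondegenerate differential 2-form. Smoothness and closedness are expressed in charts. -/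
structure SymplecticForm where
  /-- the alternating form on each tangent space -/
  form : ∀ x : M, (TangentSpace (𝓡 4) x) [⋀^Fin 2]→L[ℝ] ℝ
  smooth : ∀ x₀ : M, ContDiffOn ℝ ∞ (chartForm form x₀) (extChartAt (𝓡 4) x₀).target
  closed : ∀ x₀ : M, ∀ y ∈ (extChartAt (𝓡 4) x₀).target, extDeriv (chartForm form x₀) y = 0
  nondegenerate : ∀ (x : M) (u : TangentSpace (𝓡 4) x),
    (∀ w : TangentSpace (𝓡 4) x, form x ![u, w] = 0) → u = 0

/-- An antisymplectic involution (real structure): a smooth map `ρ` with `ρ² = id` and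
`ρ^* Ω = -Ω`. -/
structure IsAntisymplecticInvolution (Ω : SymplecticForm M) (ρ : M → M) : Prop where
  smooth : ContMDiff (𝓡 4) (𝓡 4) ∞ ρ
  involutive : Function.Involutive ρ
  pullback : ∀ (x : M) (u w : TangentSpace (𝓡 4) x),
    Ω.form (ρ x) ![mfderiv (𝓡 4) (𝓡 4) ρ x u, mfderiv (𝓡 4) (𝓡 4) ρ x w] = -Ω.form x ![u, w]

/-- By nondegeneracy every covector `α` at `x` is `Ω(·, ξ)` for a unique tangent vector `ξ`. -/
theorem SymplecticForm.existsUnique_dual (Ω : SymplecticForm M) (x : M)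
    (α : TangentSpace (𝓡 4) x →L[ℝ] ℝ) :
    ∃! ξ : TangentSpace (𝓡 4) x, ∀ w : TangentSpace (𝓡 4) x, α w = Ω.form x ![w, ξ] := by
  have hswap : ∀ u w : TangentSpace (𝓡 4) x, Ω.form x ![u, w] = -Ω.form x ![w, u] := by
    intro u w
    have h := (Ω.form x).toAlternatingMap.map_swap ![w, u] (i := 0) (j := 1) (by decide)
    have e : (![w, u] : Fin 2 → TangentSpace (𝓡 4) x) ∘ Equiv.swap 0 1 = ![u, w] := by
      ext i : 1
      fin_cases i <;> simp
    rw [e] at h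
    exact h
  have hfun : ∀ u w z : TangentSpace (𝓡 4) x, Function.update ![u, z] 1 w = ![u, w] := by
    intro u w z
    ext i : 1
    fin_cases i <;> simp
  have hfun' : ∀ u w z : TangentSpace (𝓡 4) x, Function.update ![z, w] 0 u = ![u, w] := by
    intro u w z
    ext i : 1
    fin_cases i <;> simp
  let flat : TangentSpace (𝓡 4) x →ₗ[ℝ] (TangentSpace (𝓡 4) x →ₗ[ℝ] ℝ) :=
    LinearMap.mk₂ ℝ (fun ξ w => Ω.form x ![w, ξ])
      (fun ξ η w => by
        have h := (Ω.form x).map_update_add ![w, 0] 1 ξ η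
        simpa only [hfun] using h)
      (fun c ξ w => by
        have h := (Ω.form x).map_update_smul ![w, 0] 1 c ξ
        simpa only [hfun] using h)
      (fun ξ w z => by
        have h := (Ω.form x).map_update_add ![0, ξ] 0 w z
        simpa only [hfun'] using h)
      (fun c ξ w => by
        have h := (Ω.form x).map_update_smul ![0, ξ] 0 c w
        simpa only [hfun'] using h)
  have hinj : Function.Injective flat := by
    rw [injective_iff_map_eq_zero]
    intro ξ hξ
    refine Ω.nondegenerate x ξ fun w => ?_
    rw [hswap]
    have h : Ω.form x ![w, ξ] = 0 := LinearMap.congr_fun hξ w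
    rw [h, neg_zero]
  have : FiniteDimensional ℝ (TangentSpace (𝓡 4) x) :=
    inferInstanceAs (FiniteDimensional ℝ R4)
  have hsurj : Function.Surjective flat :=
    (LinearMap.injective_iff_surjective_of_finrank_eq_finrank
      (Subspace.dual_finrank_eq (K := ℝ) (V := TangentSpace (𝓡 4) x)).symm).1 hinj
  obtain ⟨ξ, hξ⟩ := hsurj α.toLinearMap
  refine ⟨ξ, fun w => (LinearMap.congr_fun hξ w).symm, fun η hη => hinj ?_⟩
  rw [hξ]
  ext w
  exact (hη w).symm

/-- The Hamiltonian vector field `X_H`, defined by `dH = Ω(·, X_H)`. -/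
def hamiltonianVectorField (Ω : SymplecticForm M) (H : M → ℝ) (x : M) : TangentSpace (𝓡 4) x :=
  (Ω.existsUnique_dual x (mfderiv (𝓡 4) 𝓘(ℝ, ℝ) H x)).choose

theorem hamiltonianVectorField_spec (Ω : SymplecticForm M) (H : M → ℝ) (x : M)
    (w : TangentSpace (𝓡 4) x) :
    (mfderiv (𝓡 4) 𝓘(ℝ, ℝ) H x : TangentSpace (𝓡 4) x →L[ℝ] ℝ) w
      = Ω.form x ![w, hamiltonianVectorField Ω H x] :=
  (Ω.existsUnique_dual x (mfderiv (𝓡 4) 𝓘(ℝ, ℝ) H x)).choose_spec.1 w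

open Classical in
/-- The time-`t` map `φ^t` of the (possibly incomplete) flow of a vector field `X`: if `X` has an
integral curve `γ` with `γ(0) = x` on an open interval containing `0` and `t`, then `φ^t(x) = γ(t)`.
Points whose integral curve does not exist up to time `t` get the default value `x`. -/
def flowMap (X : ∀ x : M, TangentSpace (𝓡 4) x) (t : ℝ) (x : M) : M :=
  if h : ∃ γ : ℝ → M, γ 0 = x ∧
      ∃ a b : ℝ, (0 : ℝ) ∈ Ioo a b ∧ t ∈ Ioo a b ∧ IsMIntegralCurveOn γ X (Ioo a b)
  then h.choose t else x

/-- `v : ℝ/ℤ → M` is a nonconstant periodic orbit of `X_H` with period `τ > 0`, parametrized over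
`ℝ/ℤ`: it solves `∂ₜ v = τ X_H(v)`. It may be multiply covered. -/
structure IsPeriodicOrbit (Ω : SymplecticForm M) (H : M → ℝ) (v : UnitAddCircle → M) (τ : ℝ) :
    Prop where
  period_pos : 0 < τ
  ode : IsMIntegralCurve (fun t : ℝ => v (t : UnitAddCircle))
    (fun x => τ • hamiltonianVectorField Ω H x)
  nonconstant : ∃ s t : UnitAddCircle, v s ≠ v t

/-- A simple periodic orbit of period `τ`: a periodic orbit that is injective on `ℝ/ℤ`. -/
structure IsSimplePeriodicOrbit (Ω : SymplecticForm M) (H : M → ℝ) (v : UnitAddCircle → M)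
    (τ : ℝ) : Prop extends IsPeriodicOrbit Ω H v τ where
  injective : Function.Injective v

/-- A simple periodic orbit that is symmetric with respect to `ρ`: `ρ(v(-t)) = v(t)`. -/
structure IsSymmetricOrbit (Ω : SymplecticForm M) (H : M → ℝ) (ρ : M → M)
    (v : UnitAddCircle → M) (τ : ℝ) : Prop extends IsSimplePeriodicOrbit Ω H v τ where
  symmetric : ∀ t : UnitAddCircle, ρ (v (-t)) = v t

/-- A doubly symmetric periodic orbit with respect to `ρ₁` and `ρ₂`: a simple periodic orbit that
is symmetric with respect to `ρ₁` and satisfies `ρ₂(v(0)) = v(1/2)`. -/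
structure IsDoublySymmetricOrbit (Ω : SymplecticForm M) (H : M → ℝ) (ρ₁ ρ₂ : M → M)
    (v : UnitAddCircle → M) (τ : ℝ) : Prop extends IsSymmetricOrbit Ω H ρ₁ v τ where
  half : ρ₂ (v 0) = v ((1 / 2 : ℝ) : UnitAddCircle)

/-- The tangent space `T_x Σ = ker dH(x)` at `x` of the energy level `Σ = H⁻¹(H(x))`; it is used
at points where `dH(x) ≠ 0`. -/
def levelTangent (H : M → ℝ) (x : M) : Submodule ℝ (TangentSpace (𝓡 4) x) :=
  LinearMap.ker (mfderiv (𝓡 4) 𝓘(ℝ, ℝ) H x : TangentSpace (𝓡 4) x →L[ℝ] ℝ).toLinearMap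

/-- The line spanned by `X_H(x)`, as a subspace of `T_x Σ`. -/
def hamiltonianLine (Ω : SymplecticForm M) (H : M → ℝ) (x : M) :
    Submodule ℝ (levelTangent H x) :=
  (Submodule.span ℝ {hamiltonianVectorField Ω H x}).submoduleOf (levelTangent H x)

/-- The quotient `T_x Σ / ⟨X_H(x)⟩`. -/
abbrev ReducedTangent (Ω : SymplecticForm M) (H : M → ℝ) (x : M) : Type :=
  levelTangent H x ⧸ hamiltonianLine Ω H x

/-- `A` is the reduced monodromy of the periodic orbit `v` of period `τ`: the point `v(0)` is fixed
by the time-`τ` flow map, the latter is differentiable there with differential `D`, and `A` is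
the endomorphism of `T_{v(0)} Σ / ⟨X_H(v(0))⟩` induced by `D`. -/
def IsReducedMonodromy (Ω : SymplecticForm M) (H : M → ℝ) (v : UnitAddCircle → M) (τ : ℝ)
    (A : ReducedTangent Ω H (v 0) →ₗ[ℝ] ReducedTangent Ω H (v 0)) : Prop :=
  flowMap (hamiltonianVectorField Ω H) τ (v 0) = v 0 ∧
  ∃ D : TangentSpace (𝓡 4) (v 0) →L[ℝ] TangentSpace (𝓡 4) (v 0),
    HasMFDerivAt (𝓡 4) (𝓡 4) (flowMap (hamiltonianVectorField Ω H) τ) (v 0) D ∧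
    ∀ w : levelTangent H (v 0), ∃ hw : D w ∈ levelTangent H (v 0),
      A (Submodule.Quotient.mk w) = Submodule.Quotient.mk ⟨D w, hw⟩

/-- A periodic orbit is negative hyperbolic if the trace of its reduced monodromy is less than
`-2`. -/
def IsNegativeHyperbolic (Ω : SymplecticForm M) (H : M → ℝ) (v : UnitAddCircle → M) (τ : ℝ) :
    Prop :=
  ∃ A : ReducedTangent Ω H (v 0) →ₗ[ℝ] ReducedTangent Ω H (v 0),
    IsReducedMonodromy Ω H v τ A ∧ LinearMap.trace ℝ (ReducedTangent Ω H (v 0)) A < -2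

/-- The `k`-fold cover `t ↦ v(kt)` of a loop `v`. If `v` is a periodic orbit of period `τ`, this is
a periodic orbit of period `kτ`. -/
def coverLoop (k : ℕ) (v : UnitAddCircle → M) : UnitAddCircle → M := fun t => v (k • t)

/-- A periodic orbit is bad if it is an even cover of a negative hyperbolic periodic orbit. -/
def IsBadOrbit (Ω : SymplecticForm M) (H : M → ℝ) (v : UnitAddCircle → M) (τ : ℝ) : Prop :=
  ∃ (w : UnitAddCircle → M) (σ : ℝ) (k : ℕ), 0 < k ∧ Even k ∧
    IsPeriodicOrbit Ω H w σ ∧ IsNegativeHyperbolic Ω H w σ ∧ v = coverLoop k w ∧ τ = k * σ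

/-- A periodic orbit is good if it is not bad. -/
def IsGoodOrbit (Ω : SymplecticForm M) (H : M → ℝ) (v : UnitAddCircle → M) (τ : ℝ) : Prop :=
  IsPeriodicOrbit Ω H v τ ∧ ¬ IsBadOrbit Ω H v τ

end Symplectic

end

section LocalFlow

variable {E : Type*} [NormedAddCommGroup E] [NormedSpace ℝ E]

theorem exists_fundamental_solution [CompleteSpace E] {A : ℝ → E →L[ℝ] E} {K T : ℝ}
    (hK : 0 ≤ K) (hT : 0 ≤ T) (hA : ContinuousOn A (Icc 0 T)) (hAK : ∀ t ∈ Icc 0 T, ‖A t‖ ≤ K)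
    (hKT : 2 * K * T ≤ 1) :
    ∃ Φ : ℝ → E →L[ℝ] E, Φ 0 = ContinuousLinearMap.id ℝ E ∧
      ∀ t ∈ Icc 0 T, HasDerivWithinAt Φ ((A t).comp (Φ t)) (Icc 0 T) t := by
  have hpl : IsPicardLindelof (fun t (Ψ : E →L[ℝ] E) => (A t).comp Ψ) (tmin := 0) (tmax := T)
      ⟨0, left_mem_Icc.2 hT⟩ (ContinuousLinearMap.id ℝ E) 1 0 ⟨2 * K, by positivity⟩ ⟨K, hK⟩ := by
    refine ⟨fun t ht => ?_, fun Ψ _ => hA.clm_comp continuousOn_const, fun t ht Ψ hΨ => ?_, ?_⟩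
    · refine LipschitzOnWith.of_dist_le_mul fun Ψ _ Θ _ => ?_
      rw [dist_eq_norm, dist_eq_norm, ← ContinuousLinearMap.comp_sub]
      exact (ContinuousLinearMap.opNorm_comp_le _ _).trans
        (mul_le_mul_of_nonneg_right (hAK t ht) (norm_nonneg _))
    · have h1 : ‖Ψ‖ ≤ 2 := by
        have h2 : ‖Ψ - ContinuousLinearMap.id ℝ E‖ ≤ 1 := by
          simpa [dist_eq_norm] using hΨ
        have h3 := norm_le_norm_sub_add Ψ (ContinuousLinearMap.id ℝ E)
        have h4 : ‖ContinuousLinearMap.id ℝ E‖ ≤ 1 := ContinuousLinearMap.norm_id_le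
        linarith
      calc ‖(A t).comp Ψ‖ ≤ ‖A t‖ * ‖Ψ‖ := ContinuousLinearMap.opNorm_comp_le _ _
        _ ≤ K * 2 := mul_le_mul (hAK t ht) h1 (norm_nonneg _) hK
        _ = 2 * K := by ring
    · simp only [sub_zero, sub_self, max_eq_left hT, NNReal.coe_one, NNReal.coe_zero]
      exact hKT
  simpa using hpl.exists_eq_forall_mem_Icc_hasDerivWithinAt₀

theorem hasFDerivAt_flow_of_fundamental_solution {f : E → E} {y₀ : E} {R K L T r : ℝ}
    (hf : ContDiffOn ℝ 1 f (Metric.ball y₀ R)) (hK : ∀ y ∈ Metric.ball y₀ R, ‖fderiv ℝ f y‖ ≤ K)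
    (hT : 0 ≤ T) (hr : 0 < r) (hL : 0 ≤ L) {α : E → ℝ → E} {x : E}
    (hα0 : ∀ z ∈ Metric.ball x r, α z 0 = z)
    (hα : ∀ z ∈ Metric.ball x r, ∀ t ∈ Icc 0 T,
      HasDerivAt (α z) (f (α z t)) t ∧ α z t ∈ Metric.ball y₀ R)
    (hLip : ∀ z ∈ Metric.ball x r, ∀ t ∈ Icc 0 T, ‖α z t - α x t‖ ≤ L * ‖z - x‖)
    {Φ : ℝ → E →L[ℝ] E} (hΦ0 : Φ 0 = ContinuousLinearMap.id ℝ E)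
    (hΦ : ∀ t ∈ Icc 0 T,
      HasDerivWithinAt Φ ((fderiv ℝ f (α x t)).comp (Φ t)) (Icc 0 T) t) :
    HasFDerivAt (fun z => α z T) (Φ T) x := by
  have hxr : x ∈ Metric.ball x r := Metric.mem_ball_self hr
  have hK0 : 0 ≤ K := (norm_nonneg _).trans (hK _ (hα x hxr T (right_mem_Icc.2 hT)).2)
  have hfd : ∀ y ∈ Metric.ball y₀ R, DifferentiableAt ℝ f y := fun y hy =>
    (hf.differentiableOn one_ne_zero).differentiableAt (Metric.isOpen_ball.mem_nhds hy)
  have hf' : ContinuousOn (fderiv ℝ f) (Metric.ball y₀ R) :=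
    hf.continuousOn_fderiv_of_isOpen Metric.isOpen_ball le_rfl
  have hcurve : IsCompact (α x '' Icc 0 T) := isCompact_Icc.image_of_continuousOn fun t ht =>
    (hα x hxr t ht).1.continuousAt.continuousWithinAt
  have hG : 0 ≤ gronwallBound 0 K 1 T := by
    have := gronwallBound_mono (δ := 0) (ε := 1) le_rfl zero_le_one hK0 hT
    simpa [gronwallBound_x0] using this
  rw [hasFDerivAt_iff_isLittleO, Asymptotics.isLittleO_iff]
  intro c hc
  obtain ⟨η, hη, hηc⟩ : ∃ η > 0, η * (L * gronwallBound 0 K 1 T) ≤ c := by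
    refine ⟨c / (L * gronwallBound 0 K 1 T + 1), by positivity, ?_⟩
    rw [div_mul_eq_mul_div, div_le_iff₀ (by positivity)]
    nlinarith
  obtain ⟨δ, hδ, hunif⟩ : ∃ δ > 0, ∀ t ∈ Icc 0 T, ∀ y, ‖y - α x t‖ < δ →
      ‖fderiv ℝ f y - fderiv ℝ f (α x t)‖ ≤ η := by
    have := hcurve.uniformContinuousAt_of_continuousAt (fderiv ℝ f)
      (by
        rintro _ ⟨t, ht, rfl⟩
        exact hf'.continuousAt (Metric.isOpen_ball.mem_nhds (hα x hxr t ht).2))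
      (Metric.dist_mem_uniformity hη)
    obtain ⟨δ, hδ, h⟩ := Metric.mem_uniformity_dist.1 this
    refine ⟨δ, hδ, fun t ht y hy => ?_⟩
    have h1 := @h (α x t) y (by rwa [dist_comm, dist_eq_norm]) ⟨t, ht, rfl⟩
    rw [← dist_eq_norm, dist_comm]
    exact le_of_lt h1
  have hnear : Metric.ball x (min r (δ / (L + 1))) ∈ 𝓝 x :=
    Metric.ball_mem_nhds _ (lt_min hr (by positivity))
  filter_upwards [hnear] with z hz
  have hzr : z ∈ Metric.ball x r := Metric.ball_subset_ball (min_le_left _ _) hz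
  have hzδ : ‖z - x‖ < δ / (L + 1) := by
    rw [← dist_eq_norm]; exact (Metric.mem_ball.1 hz).trans_le (min_le_right _ _)
  have hclose : ∀ t ∈ Icc 0 T, ‖α z t - α x t‖ < δ := fun t ht => by
    refine (hLip z hzr t ht).trans_lt ?_
    rw [lt_div_iff₀ (by positivity)] at hzδ
    nlinarith [norm_nonneg (z - x)]
  have hrem : ∀ t ∈ Icc 0 T, ‖f (α z t) - f (α x t) - fderiv ℝ f (α x t) (α z t - α x t)‖
      ≤ η * (L * ‖z - x‖) := fun t ht => by
    have hconv : Convex ℝ (Metric.ball y₀ R ∩ Metric.ball (α x t) δ) :=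
      (convex_ball _ _).inter (convex_ball _ _)
    have := hconv.norm_image_sub_le_of_norm_fderiv_le' (𝕜 := ℝ) (f := f) (C := η)
      (φ := fderiv ℝ f (α x t)) (fun y hy => hfd y hy.1)
      (fun y hy => hunif t ht y (by rw [← dist_eq_norm]; exact hy.2))
      ⟨(hα x hxr t ht).2, Metric.mem_ball_self hδ⟩
      ⟨(hα z hzr t ht).2, by rw [Metric.mem_ball, dist_eq_norm]; exact hclose t ht⟩
    exact this.trans (mul_le_mul_of_nonneg_left (hLip z hzr t ht) hη.le)
  have hgr := norm_le_gronwallBound_of_norm_deriv_right_le (a := 0) (b := T) (δ := 0) (K := K)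
    (ε := η * (L * ‖z - x‖))
    (f := fun t => α z t - α x t - Φ t (z - x))
    (f' := fun t => f (α z t) - f (α x t) - fderiv ℝ f (α x t) (Φ t (z - x)))
    (by
      intro t ht
      have h1 := (hα z hzr t ht).1.continuousAt.continuousWithinAt (s := Icc 0 T)
      have h2 := (hα x hxr t ht).1.continuousAt.continuousWithinAt (s := Icc 0 T)
      exact (h1.sub h2).sub ((hΦ t ht).continuousWithinAt.clm_apply continuousWithinAt_const))
    (by
      intro t ht
      have ht' := Ico_subset_Icc_self ht
      have h1 := (hα z hzr t ht').1.hasDerivWithinAt (s := Ici t)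
      have h2 := (hα x hxr t ht').1.hasDerivWithinAt (s := Ici t)
      have h3 : HasDerivWithinAt Φ ((fderiv ℝ f (α x t)).comp (Φ t)) (Ici t) t :=
        (hΦ t ht').mono_of_mem_nhdsWithin (Icc_mem_nhdsGE_of_mem ht)
      have h4 := h3.clm_apply (hasDerivWithinAt_const t (Ici t) (z - x))
      exact ((h1.sub h2).sub h4).congr_deriv (by simp))
    (by simp [hΦ0, hα0 z hzr, hα0 x hxr])
    (by
      intro t ht
      have ht' := Ico_subset_Icc_self ht
      have e : f (α z t) - f (α x t) - fderiv ℝ f (α x t) (Φ t (z - x))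
          = fderiv ℝ f (α x t) (α z t - α x t - Φ t (z - x))
            + (f (α z t) - f (α x t) - fderiv ℝ f (α x t) (α z t - α x t)) := by
        simp only [map_sub]; abel
      rw [e]
      refine (norm_add_le _ _).trans (add_le_add ?_ (hrem t ht'))
      exact (ContinuousLinearMap.le_opNorm _ _).trans
        (mul_le_mul_of_nonneg_right (hK _ (hα x hxr t ht').2) (norm_nonneg _)))
    T (right_mem_Icc.2 hT)
  have hscale : ∀ e, gronwallBound 0 K e T = e * gronwallBound 0 K 1 T := fun e => by
    by_cases h : K = 0
    · simp [h, gronwallBound_K0]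
    · simp [gronwallBound_of_K_ne_0 h]; ring
  rw [sub_zero, hscale] at hgr
  calc ‖α z T - α x T - Φ T (z - x)‖ ≤ _ := hgr
    _ = η * (L * gronwallBound 0 K 1 T) * ‖z - x‖ := by ring
    _ ≤ c * ‖z - x‖ := mul_le_mul_of_nonneg_right hηc (norm_nonneg _)

/-- A vector field of class `C¹` near `y₀` has a local flow, which stays in a prescribed
neighbourhood of `y₀` and is differentiable with respect to the initial point. -/
theorem ContDiffAt.exists_local_flow_differentiableAt [CompleteSpace E] {f : E → E} {y₀ : E}
    (hf : ContDiffAt ℝ 1 f y₀) {U : Set E} (hU : U ∈ 𝓝 y₀) :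
    ∃ ε > 0, ∃ r > 0, ∃ α : E → ℝ → E, ∀ x ∈ Metric.ball y₀ r, α x 0 = x ∧
      (∀ t ∈ Ioo (-ε) ε, HasDerivAt (α x) (f (α x t)) t ∧ α x t ∈ U) ∧
      ∀ t ∈ Ico 0 ε, DifferentiableAt ℝ (fun z => α z t) x := by
  obtain ⟨V, hV, hfV⟩ := hf.contDiffOn (m := 1) le_rfl (by simp)
  have hK : ∀ᶠ y in 𝓝 y₀, ‖fderiv ℝ f y‖ < ‖fderiv ℝ f y₀‖ + 1 :=
    (hf.continuousAt_fderiv one_ne_zero).norm.eventually_lt continuousAt_const (by simp)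
  obtain ⟨R, hR, hRs⟩ := Metric.mem_nhds_iff.1 (Filter.inter_mem (Filter.inter_mem hV hU) hK)
  set K := ‖fderiv ℝ f y₀‖ + 1 with hKdef
  have hK0 : 0 < K := by positivity
  obtain ⟨ε₀, hε₀, a, r, L, K', hr, hpl⟩ := IsPicardLindelof.of_contDiffAt_one hf
  obtain ⟨α, hα, L', hL'⟩ :=
    (hpl 0).exists_forall_mem_closedBall_eq_hasDerivWithinAt_lipschitzOnWith
  have hcont : ContinuousOn (Function.uncurry α)
      (Metric.closedBall y₀ r ×ˢ Icc (0 - ε₀) (0 + ε₀)) :=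
    continuousOn_prod_of_continuousOn_lipschitzOnWith _ L'
      (fun x hx => HasDerivWithinAt.continuousOn (hα x hx).2) hL'
  have hca : ContinuousAt (Function.uncurry α) (y₀, 0) := hcont.continuousAt
    (prod_mem_nhds (Metric.closedBall_mem_nhds _ hr) (Icc_mem_nhds (by linarith) (by linarith)))
  have hα00 : Function.uncurry α (y₀, 0) = y₀ :=
    (hα y₀ (Metric.mem_closedBall_self r.2)).1
  have hnear := hca.preimage_mem_nhds (t := Metric.ball y₀ R)
    (by rw [hα00]; exact Metric.ball_mem_nhds _ hR)
  obtain ⟨δ, hδ, hδs⟩ := Metric.mem_nhds_iff.1 hnear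
  refine ⟨min (min ε₀ δ) (1 / (2 * K)), by positivity, min r δ, lt_min hr hδ, α, fun x hx => ?_⟩
  set ε := min (min ε₀ δ) (1 / (2 * K)) with hεdef
  have hε1 : ε ≤ ε₀ := (min_le_left _ _).trans (min_le_left _ _)
  have hε2 : ε ≤ δ := (min_le_left _ _).trans (min_le_right _ _)
  have hε3 : ε ≤ 1 / (2 * K) := min_le_right _ _
  have hball : Metric.ball y₀ (min r δ) ⊆ Metric.closedBall y₀ r :=
    (Metric.ball_subset_ball (min_le_left _ _)).trans Metric.ball_subset_closedBall
  have key : ∀ z ∈ Metric.ball y₀ (min r δ), ∀ t ∈ Ioo (-ε) ε,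
      HasDerivAt (α z) (f (α z t)) t ∧ α z t ∈ Metric.ball y₀ R := fun z hz t ht => by
    refine ⟨((hα z (hball hz)).2 t ⟨by linarith [ht.1], by linarith [ht.2]⟩).hasDerivAt
      (Icc_mem_nhds (by linarith [ht.1]) (by linarith [ht.2])), hδs (a := (z, t)) ?_⟩
    rw [← ball_prod_same]
    refine ⟨Metric.ball_subset_ball (min_le_right _ _) hz, ?_⟩
    rw [Metric.mem_ball, Real.dist_eq, sub_zero]
    exact (abs_lt.2 ht).trans_le hε2
  refine ⟨(hα x (hball hx)).1, fun t ht => ⟨(key x hx t ht).1, (hRs (key x hx t ht).2).1.2⟩,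
    fun T hT => ?_⟩
  have hsub : Icc 0 T ⊆ Ioo (-ε) ε := fun t ht =>
    ⟨by linarith [ht.1, ht.2, hT.1, hT.2], by linarith [ht.2, hT.2]⟩
  have hfR : ContDiffOn ℝ 1 f (Metric.ball y₀ R) := hfV.mono fun y hy => (hRs hy).1.1
  have hKR : ∀ y ∈ Metric.ball y₀ R, ‖fderiv ℝ f y‖ ≤ K := fun y hy => le_of_lt (hRs hy).2
  obtain ⟨ρ, hρ, hρs⟩ := Metric.isOpen_iff.1 Metric.isOpen_ball x hx
  obtain ⟨Φ, hΦ0, hΦ⟩ := exists_fundamental_solution (A := fun t => fderiv ℝ f (α x t))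
    hK0.le hT.1
    ((hfR.continuousOn_fderiv_of_isOpen Metric.isOpen_ball le_rfl).comp
      (fun t ht => (key x hx t (hsub ht)).1.continuousAt.continuousWithinAt)
      (fun t ht => (key x hx t (hsub ht)).2))
    (fun t ht => hKR _ (key x hx t (hsub ht)).2)
    (by
      have := hT.2.le.trans hε3
      rw [le_div_iff₀ (by positivity)] at this
      linarith)
  exact (hasFDerivAt_flow_of_fundamental_solution hfR hKR hT.1 hρ L'.2
    (fun z hz => (hα z (hball (hρs hz))).1)
    (fun z hz t ht => key z (hρs hz) t (hsub ht))
    (fun z hz t ht => by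
      have h := hsub ht
      have := (hL' t ⟨by linarith [h.1], by linarith [h.2]⟩).dist_le_mul z (hball (hρs hz)) x
        (hball hx)
      rwa [dist_eq_norm, dist_eq_norm] at this)
    hΦ0 hΦ).differentiableAt

end LocalFlow

section Currying

variable {E : Type*} [NormedAddCommGroup E] [NormedSpace ℝ E]

/-- The bilinear map of an alternating 2-form. -/
noncomputable def curryTwoForm (η : E [⋀^Fin 2]→L[ℝ] ℝ) : E →L[ℝ] E →L[ℝ] ℝ :=
  (ContinuousAlternatingMap.ofSubsingletonLIE (𝕜 := ℝ) (E := E) (F := ℝ)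
    (0 : Fin 1)).symm.toContinuousLinearEquiv.toContinuousLinearMap.comp
      (ContinuousAlternatingMap.curryLeftLI (𝕜 := ℝ) (E := E) (F := ℝ) (n := 1) η)

theorem curryTwoForm_apply (η : E [⋀^Fin 2]→L[ℝ] ℝ) (u w : E) :
    curryTwoForm η u w = η ![u, w] := by
  change η (Matrix.vecCons u fun _ => w) = η ![u, w]
  congr 1
  ext i : 1
  fin_cases i <;> rfl

theorem contDiff_curryTwoForm {n : WithTop ℕ∞} :
    ContDiff ℝ n (curryTwoForm : (E [⋀^Fin 2]→L[ℝ] ℝ) → E →L[ℝ] E →L[ℝ] ℝ) := by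
  refine IsBoundedLinearMap.contDiff (IsLinearMap.with_bound ⟨fun η θ => ?_, fun c η => ?_⟩ 1
    fun η => ?_)
  · ext u w
    simp [curryTwoForm_apply]
  · ext u w
    simp [curryTwoForm_apply]
  · rw [one_mul]
    refine ContinuousLinearMap.opNorm_le_bound₂ _ (norm_nonneg _) fun u w => ?_
    rw [curryTwoForm_apply]
    simpa [Fin.prod_univ_two, mul_assoc] using η.le_opNorm ![u, w]

theorem ContinuousAlternatingMap.apply_two_swap (η : E [⋀^Fin 2]→L[ℝ] ℝ) (u w : E) :
    η ![u, w] = -η ![w, u] := by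
  have h := η.toAlternatingMap.map_swap ![w, u] (i := 0) (j := 1) (by decide)
  have e : (![w, u] : Fin 2 → E) ∘ Equiv.swap 0 1 = ![u, w] := by
    ext i : 1
    fin_cases i <;> simp
  rw [e] at h
  exact h

/-- The solution `ξ` of `η_y(w, ξ) = a_y(w)` depends smoothly on `y` when the 2-form `η` and the
covector `a` do. -/
theorem contDiffAt_dual_of_twoForm [FiniteDimensional ℝ E] {η : E → E [⋀^Fin 2]→L[ℝ] ℝ}
    {a : E → E →L[ℝ] ℝ} {ξ : E → E} {y : E} {n : WithTop ℕ∞}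
    (hη : ContDiffAt ℝ n η y) (ha : ContDiffAt ℝ n a y)
    (hnd : ∀ᶠ z in 𝓝 y, ∀ u, (∀ w, η z ![u, w] = 0) → u = 0)
    (hξ : ∀ᶠ z in 𝓝 y, ∀ w, η z ![w, ξ z] = a z w) : ContDiffAt ℝ n ξ y := by
  have : CompleteSpace E := FiniteDimensional.complete ℝ E
  have hequiv : ∀ᶠ z in 𝓝 y, ∃ e : E ≃L[ℝ] (E →L[ℝ] ℝ),
      (e : E →L[ℝ] E →L[ℝ] ℝ) = curryTwoForm (η z) := by
    filter_upwards [hnd] with z hz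
    have hinj : Function.Injective (curryTwoForm (η z)) := by
      rw [injective_iff_map_eq_zero]
      intro u hu
      exact hz u fun w => by rw [← curryTwoForm_apply, hu]; rfl
    have hfr : Module.finrank ℝ E = Module.finrank ℝ (E →L[ℝ] ℝ) := by
      rw [← (LinearMap.toContinuousLinearMap (𝕜 := ℝ) (E := E) (F' := ℝ)).finrank_eq]
      exact (Subspace.dual_finrank_eq (K := ℝ) (V := E)).symm
    let e := (LinearEquiv.ofInjectiveOfFinrankEq
      (curryTwoForm (η z) : E →ₗ[ℝ] E →L[ℝ] ℝ) hinj hfr).toContinuousLinearEquiv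
    exact ⟨e, by ext; rfl⟩
  obtain ⟨e, he⟩ := hequiv.self_of_nhds
  have hinv : ContDiffAt ℝ n (fun z => (curryTwoForm (η z)).inverse) y :=
    ContDiffAt.comp (g := ContinuousLinearMap.inverse) (f := fun z => curryTwoForm (η z)) y
      (he ▸ contDiffAt_map_inverse e)
      (ContDiffAt.comp (g := curryTwoForm) (f := η) y
        contDiff_curryTwoForm.contDiffAt hη)
  refine (hinv.clm_apply ha.neg).congr_of_eventuallyEq ?_
  filter_upwards [hequiv, hξ] with z ⟨e, he⟩ hz
  rw [← he, ContinuousLinearMap.inverse_equiv]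
  have h : curryTwoForm (η z) (ξ z) = -a z := by
    ext w
    rw [curryTwoForm_apply, ContinuousAlternatingMap.apply_two_swap, hz]
    rfl
  rw [← h, ← he]
  simp

end Currying

section ChartField

variable {M : Type*} [TopologicalSpace M] [ChartedSpace R4 M]

/-- The expression of a vector field in the chart around `p`. -/
noncomputable def chartField (X : ∀ x : M, TangentSpace (𝓡 4) x) (p : M) (y : R4) : R4 :=
  mfderiv (𝓡 4) 𝓘(ℝ, R4) (extChartAt (𝓡 4) p) ((extChartAt (𝓡 4) p).symm y)
    (X ((extChartAt (𝓡 4) p).symm y))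

theorem chartForm_apply (Ω : ∀ x : M, (TangentSpace (𝓡 4) x) [⋀^Fin 2]→L[ℝ] ℝ) (p : M) (y : R4)
    (u w : R4) :
    chartForm Ω p y ![u, w] = Ω ((extChartAt (𝓡 4) p).symm y)
      ![mfderiv 𝓘(ℝ, R4) (𝓡 4) (extChartAt (𝓡 4) p).symm y u,
        mfderiv 𝓘(ℝ, R4) (𝓡 4) (extChartAt (𝓡 4) p).symm y w] :=
  congrArg (Ω ((extChartAt (𝓡 4) p).symm y)) (by ext i : 1; fin_cases i <;> rfl)

variable [IsManifold (𝓡 4) 1 M]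

theorem mfderiv_extChartAt_symm_mfderiv {p : M} {y : R4} (hy : y ∈ (extChartAt (𝓡 4) p).target)
    (ξ : TangentSpace (𝓡 4) ((extChartAt (𝓡 4) p).symm y)) :
    mfderiv 𝓘(ℝ, R4) (𝓡 4) (extChartAt (𝓡 4) p).symm y
      (mfderiv (𝓡 4) 𝓘(ℝ, R4) (extChartAt (𝓡 4) p) ((extChartAt (𝓡 4) p).symm y) ξ) = ξ := by
  have h := mfderivWithin_extChartAt_symm_comp_mfderiv_extChartAt (I := 𝓡 4) hy
  rw [ModelWithCorners.Boundaryless.range_eq_univ, mfderivWithin_univ] at h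
  exact congrArg (fun A => A ξ) h

theorem mfderiv_extChartAt_mfderiv_symm {p : M} {y : R4} (hy : y ∈ (extChartAt (𝓡 4) p).target)
    (w : R4) :
    mfderiv (𝓡 4) 𝓘(ℝ, R4) (extChartAt (𝓡 4) p) ((extChartAt (𝓡 4) p).symm y)
      (mfderiv 𝓘(ℝ, R4) (𝓡 4) (extChartAt (𝓡 4) p).symm y w) = w := by
  have h := mfderiv_extChartAt_comp_mfderivWithin_extChartAt_symm (I := 𝓡 4) hy
  rw [ModelWithCorners.Boundaryless.range_eq_univ, mfderivWithin_univ] at h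
  exact congrArg (fun A => A w) h

theorem mdifferentiableAt_extChartAt_symm_of_mem {p : M} {y : R4}
    (hy : y ∈ (extChartAt (𝓡 4) p).target) :
    MDifferentiableAt 𝓘(ℝ, R4) (𝓡 4) (extChartAt (𝓡 4) p).symm y := by
  have h := mdifferentiableWithinAt_extChartAt_symm (I := 𝓡 4) hy
  rwa [ModelWithCorners.Boundaryless.range_eq_univ, mdifferentiableWithinAt_univ] at h

theorem contMDiff_section_of_chartField {X : ∀ x : M, TangentSpace (𝓡 4) x}
    (hX : ∀ p, ContDiffAt ℝ 1 (chartField X p) (extChartAt (𝓡 4) p p)) :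
    ContMDiff (𝓡 4) (𝓡 4).tangent 1 (fun x => (⟨x, X x⟩ : TangentBundle (𝓡 4) M)) := by
  intro p
  rw [Bundle.contMDiffAt_section]
  have h : ContMDiffAt (𝓡 4) 𝓘(ℝ, R4) 1 (chartField X p ∘ extChartAt (𝓡 4) p) p :=
    (hX p).contMDiffAt.comp p (contMDiffAt_extChartAt)
  refine h.congr_of_eventuallyEq ?_
  filter_upwards [(chartAt R4 p).open_source.mem_nhds (mem_chart_source R4 p)] with q hq
  have h1 := TangentBundle.continuousLinearMapAt_trivializationAt (I := 𝓡 4) hq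
  have h2 : (extChartAt (𝓡 4) p).symm (extChartAt (𝓡 4) p q) = q :=
    (extChartAt (𝓡 4) p).left_inv (by rwa [extChartAt_source])
  have h3 := congrArg (fun A => A (X q)) h1
  simp only [Function.comp_apply, chartField]
  rw [h2]
  refine Eq.trans ?_ h3
  rw [Bundle.Trivialization.continuousLinearMapAt_apply]
  rw [Bundle.Trivialization.coe_linearMapAt_of_mem]
  simpa using hq

/-- An integral curve of the chart expression of a vector field is mapped to an integral curve by
the inverse of the chart. -/
theorem hasMFDerivAt_extChartAt_symm_comp {X : ∀ x : M, TangentSpace (𝓡 4) x} {p : M}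
    {c : ℝ → R4} {t : ℝ} (hc : HasDerivAt c (chartField X p (c t)) t)
    (ht : c t ∈ (extChartAt (𝓡 4) p).target) :
    HasMFDerivAt 𝓘(ℝ, ℝ) (𝓡 4) (fun s => (extChartAt (𝓡 4) p).symm (c s)) t
      ((1 : ℝ →L[ℝ] ℝ).smulRight (X ((extChartAt (𝓡 4) p).symm (c t)))) := by
  have h := (mdifferentiableAt_extChartAt_symm_of_mem ht).hasMFDerivAt.comp t
    hc.hasFDerivAt.hasMFDerivAt
  refine h.congr_mfderiv ?_
  ext1
  exact (congrArg _ (one_smul ℝ _)).trans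
    ((mfderiv_extChartAt_symm_mfderiv ht _).trans (one_smul ℝ _).symm)

end ChartField

section Hamiltonian

variable {M : Type*} [TopologicalSpace M] [ChartedSpace R4 M] [IsManifold (𝓡 4) ∞ M]

theorem contDiffAt_chartField_hamiltonian (Ω : SymplecticForm M) {H : M → ℝ}
    (hH : ContMDiff (𝓡 4) 𝓘(ℝ, ℝ) ∞ H) (p : M) {y : R4} (hy : y ∈ (extChartAt (𝓡 4) p).target) :
    ContDiffAt ℝ 1 (chartField (hamiltonianVectorField Ω H) p) y := by
  have : IsManifold (𝓡 4) 1 M := IsManifold.of_le (n := ∞) (by simp)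
  have hopen : IsOpen (extChartAt (𝓡 4) p).target := isOpen_extChartAt_target p
  have hnear := hopen.mem_nhds hy
  have hHs : ContMDiffOn 𝓘(ℝ, R4) 𝓘(ℝ, ℝ) ∞ (H ∘ (extChartAt (𝓡 4) p).symm)
      (extChartAt (𝓡 4) p).target :=
    hH.comp_contMDiffOn (contMDiffOn_extChartAt_symm p)
  refine contDiffAt_dual_of_twoForm (η := chartForm Ω.form p)
    (a := fun z => fderiv ℝ (H ∘ (extChartAt (𝓡 4) p).symm) z)
    ((Ω.smooth p).contDiffAt hnear |>.of_le (by simp))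
    ((hHs.contDiffOn.contDiffAt hnear).fderiv_right (m := 1) (by norm_cast)) ?_ ?_
  · filter_upwards [hnear] with z hz u hu
    have h := Ω.nondegenerate _ (mfderiv 𝓘(ℝ, R4) (𝓡 4) (extChartAt (𝓡 4) p).symm z u) ?_
    · rw [← mfderiv_extChartAt_mfderiv_symm hz u, h]
      exact map_zero _
    · intro w
      have h1 := (chartForm_apply _ _ _ _ _).symm.trans
        (hu (mfderiv (𝓡 4) 𝓘(ℝ, R4) (extChartAt (𝓡 4) p) _ w))
      rwa [mfderiv_extChartAt_symm_mfderiv hz w] at h1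
  · filter_upwards [hnear] with z hz w
    rw [chartForm_apply, chartField, mfderiv_extChartAt_symm_mfderiv hz,
      ← hamiltonianVectorField_spec, ← mfderiv_eq_fderiv,
      mfderiv_comp z ((hH.mdifferentiable (by simp)) _)
        (mdifferentiableAt_extChartAt_symm_of_mem hz)]
    rfl

end Hamiltonian

section Flow

variable {M : Type*} [TopologicalSpace M] [ChartedSpace R4 M]

/-- The vector field `X` has an integral curve that starts at `x` at time `0` and is at `y` at
time `t`. -/
def FlowsTo (X : ∀ x : M, TangentSpace (𝓡 4) x) (t : ℝ) (x y : M) : Prop :=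
  ∃ γ : ℝ → M, γ 0 = x ∧ γ t = y ∧
    ∃ a b : ℝ, (0 : ℝ) ∈ Ioo a b ∧ t ∈ Ioo a b ∧ IsMIntegralCurveOn γ X (Ioo a b)

/-- The time-`t` map of the flow of `X` is defined near `x` and differentiable at `x`. -/
def FlowDifferentiableAt (X : ∀ x : M, TangentSpace (𝓡 4) x) (t : ℝ) (x : M) : Prop :=
  (∀ᶠ z in 𝓝 x, FlowsTo X t z (flowMap X t z)) ∧
    MDifferentiableAt (𝓡 4) (𝓡 4) (flowMap X t) x

variable {X : ∀ x : M, TangentSpace (𝓡 4) x} {s t : ℝ} {x y z : M}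

theorem isMIntegralCurveOn_of_hasMFDerivAt {γ : ℝ → M} {u : Set ℝ}
    (h : ∀ t ∈ u, HasMFDerivAt 𝓘(ℝ, ℝ) (𝓡 4) γ t ((1 : ℝ →L[ℝ] ℝ).smulRight (X (γ t)))) :
    IsMIntegralCurveOn γ X u :=
  fun t ht => (h t ht).hasMFDerivWithinAt

theorem IsMIntegralCurveOn.hasMFDerivAt_of_mem_Ioo {γ : ℝ → M} {a b : ℝ}
    (h : IsMIntegralCurveOn γ X (Ioo a b)) (ht : t ∈ Ioo a b) :
    HasMFDerivAt 𝓘(ℝ, ℝ) (𝓡 4) γ t ((1 : ℝ →L[ℝ] ℝ).smulRight (X (γ t))) :=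
  (h t ht).hasMFDerivAt (Ioo_mem_nhds ht.1 ht.2)

theorem IsMIntegralCurve.flowsTo {γ : ℝ → M} (hγ : IsMIntegralCurve γ X) (s t : ℝ) :
    FlowsTo X t (γ s) (γ (s + t)) := by
  refine ⟨γ ∘ (· + s), by simp, by simp [add_comm], -(|t| + 1), |t| + 1,
    ⟨by linarith [abs_nonneg t], by linarith [abs_nonneg t]⟩,
    ⟨by linarith [neg_abs_le t], by linarith [le_abs_self t]⟩,
    (hγ.comp_add s).isMIntegralCurveOn _⟩

/-- A map that reverses `X` reverses its flow lines. -/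
theorem FlowsTo.map_of_neg {ρ : M → M} (hρ : MDifferentiable (𝓡 4) (𝓡 4) ρ)
    (hX : ∀ x, mfderiv (𝓡 4) (𝓡 4) ρ x (X x) = -X (ρ x)) (h : FlowsTo X t x y) :
    FlowsTo X t (ρ y) (ρ x) := by
  obtain ⟨γ, h0, ht, a, b, h0m, htm, hγ⟩ := h
  refine ⟨fun s => ρ (γ (t - s)), by simp [ht], by simp [h0], t - b, t - a,
    ⟨by linarith [htm.2], by linarith [htm.1]⟩, ⟨by linarith [h0m.2], by linarith [h0m.1]⟩,
    isMIntegralCurveOn_of_hasMFDerivAt fun s hs => ?_⟩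
  have h1 := hγ.hasMFDerivAt_of_mem_Ioo (t := t - s) ⟨by linarith [hs.2], by linarith [hs.1]⟩
  have h2 : HasMFDerivAt 𝓘(ℝ, ℝ) 𝓘(ℝ, ℝ) (fun s : ℝ => t - s) s
      ((1 : ℝ →L[ℝ] ℝ).smulRight (-1 : ℝ)) :=
    ((hasDerivAt_id s).const_sub t).hasFDerivAt.hasMFDerivAt
  have h3 := (hρ (γ (t - s))).hasMFDerivAt.comp s (h1.comp s h2)
  refine h3.congr_mfderiv ?_
  ext1
  change mfderiv (𝓡 4) (𝓡 4) ρ (γ (t - s)) (((1 : ℝ) • (-1 : ℝ)) • X (γ (t - s)))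
    = (1 : ℝ) • X (ρ (γ (t - s)))
  rw [map_smul, hX]
  simp

/-- A function annihilated by `X` is constant along the flow lines of `X`. -/
theorem FlowsTo.apply_eq {H : M → ℝ} (hH : MDifferentiable (𝓡 4) 𝓘(ℝ, ℝ) H)
    (hX : ∀ x, mfderiv (𝓡 4) 𝓘(ℝ, ℝ) H x (X x) = (0 : ℝ)) (h : FlowsTo X t x y) : H y = H x := by
  obtain ⟨γ, h0, ht, a, b, h0m, htm, hγ⟩ := h
  have hd : ∀ s ∈ Ioo a b, HasDerivAt (H ∘ γ) 0 s := fun s hs => by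
    have h1 := (hH (γ s)).hasMFDerivAt.comp s (hγ.hasMFDerivAt_of_mem_Ioo hs)
    have h2 : HasFDerivAt (H ∘ γ) (0 : ℝ →L[ℝ] ℝ) s := by
      refine hasMFDerivAt_iff_hasFDerivAt.1 (h1.congr_mfderiv ?_)
      ext1
      change mfderiv (𝓡 4) 𝓘(ℝ, ℝ) H (γ s) ((1 : ℝ) • X (γ s)) = (0 : ℝ)
      rw [one_smul]
      exact hX _
    simpa using h2.hasDerivAt
  have := isOpen_Ioo.is_const_of_deriv_eq_zero isPreconnected_Ioo
    (fun s hs => (hd s hs).differentiableAt.differentiableWithinAt)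
    (fun s hs => (hd s hs).deriv) htm h0m
  rw [← h0, ← ht]
  exact this

variable [T2Space M] [IsManifold (𝓡 4) 1 M]

theorem FlowsTo.flowMap_eq
    (hX : ∀ p, ContDiffAt ℝ 1 (chartField X p) (extChartAt (𝓡 4) p p)) (h : FlowsTo X t x y) :
    flowMap X t x = y := by
  obtain ⟨γ, h0, ht, a, b, h0m, htm, hγ⟩ := h
  have hex : ∃ γ : ℝ → M, γ 0 = x ∧
      ∃ a b : ℝ, (0 : ℝ) ∈ Ioo a b ∧ t ∈ Ioo a b ∧ IsMIntegralCurveOn γ X (Ioo a b) :=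
    ⟨γ, h0, a, b, h0m, htm, hγ⟩
  rw [flowMap, dif_pos hex]
  obtain ⟨g0, c, d, g0m, gtm, hg⟩ := hex.choose_spec
  rw [← ht]
  refine isMIntegralCurveOn_Ioo_eqOn_of_contMDiff_boundaryless (t₀ := 0)
    (a := max a c) (b := min b d) ⟨max_lt h0m.1 g0m.1, lt_min h0m.2 g0m.2⟩
    (contMDiff_section_of_chartField hX)
    (hg.mono (Ioo_subset_Ioo (le_max_right _ _) (min_le_right _ _)))
    (hγ.mono (Ioo_subset_Ioo (le_max_left _ _) (min_le_left _ _)))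
    (g0.trans h0.symm) ⟨max_lt htm.1 gtm.1, lt_min htm.2 gtm.2⟩

theorem FlowsTo.trans
    (hX : ∀ p, ContDiffAt ℝ 1 (chartField X p) (extChartAt (𝓡 4) p p))
    (h₁ : FlowsTo X s x y) (h₂ : FlowsTo X t y z) : FlowsTo X (s + t) x z := by
  obtain ⟨γ, h0, hs, a, b, h0m, hsm, hγ⟩ := h₁
  obtain ⟨β, k0, kt, c, d, k0m, ktm, hβ⟩ := h₂
  have hβ' : IsMIntegralCurveOn (β ∘ (· - s)) X (Ioo (c + s) (d + s)) :=
    (isMIntegralCurveOn_comp_sub.2 hβ).mono fun u hu =>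
      (⟨by linarith [hu.1], by linarith [hu.2]⟩ : u - s ∈ Ioo c d)
  have hsm' : s ∈ Ioo (c + s) (d + s) := ⟨by linarith [k0m.1], by linarith [k0m.2]⟩
  have hst : s + t ∈ Ioo (c + s) (d + s) := ⟨by linarith [ktm.1], by linarith [ktm.2]⟩
  have hval : γ s = (β ∘ (· - s)) s := by simp [hs, k0]
  have hsec := contMDiff_section_of_chartField hX
  classical
  have hunion : Ioo a b ∪ Ioo (c + s) (d + s) = Ioo (min a (c + s)) (max b (d + s)) :=
    Ioo_union_Ioo' (hsm'.1.trans hsm.2) (hsm.1.trans hsm'.2)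
  refine ⟨piecewise (Ioo a b) γ (β ∘ (· - s)), ?_, ?_, min a (c + s), max b (d + s), ?_, ?_, ?_⟩
  · rw [piecewise_eq_of_mem _ _ _ h0m, h0]
  · rw [eqOn_piecewise_of_isMIntegralCurveOn_Ioo hsec hγ hβ' ⟨hsm, hsm'⟩ hval hst]
    simp [kt]
  · rw [← hunion]; exact Or.inl h0m
  · rw [← hunion]; exact Or.inr hst
  · rw [← hunion]
    exact isMIntegralCurveOn_piecewise hsec hγ hβ' ⟨hsm, hsm'⟩ hval

theorem FlowDifferentiableAt.add
    (hX : ∀ p, ContDiffAt ℝ 1 (chartField X p) (extChartAt (𝓡 4) p p))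
    (h₁ : FlowDifferentiableAt X s x) (h₂ : FlowDifferentiableAt X t (flowMap X s x)) :
    FlowDifferentiableAt X (s + t) x := by
  have h : ∀ᶠ z in 𝓝 x, FlowsTo X (s + t) z (flowMap X t (flowMap X s z)) := by
    filter_upwards [h₁.1, h₁.2.continuousAt.eventually h₂.1] with z hz hz'
    exact hz.trans hX hz'
  refine ⟨h.mono fun z hz => by rwa [hz.flowMap_eq hX], ?_⟩
  exact (h₂.2.comp x h₁.2).congr_of_eventuallyEq (h.mono fun z hz => hz.flowMap_eq hX)

theorem eventually_flowDifferentiableAt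
    (hX : ∀ p, ContDiffAt ℝ 1 (chartField X p) (extChartAt (𝓡 4) p p)) (p : M) :
    ∃ ε > 0, ∀ᶠ q in 𝓝 p, ∀ t ∈ Ico 0 ε, FlowDifferentiableAt X t q := by
  obtain ⟨ε, hε, r, hr, α, hα⟩ :=
    (hX p).exists_local_flow_differentiableAt (extChartAt_target_mem_nhds p)
  have hV : ∀ᶠ q in 𝓝 p, q ∈ (extChartAt (𝓡 4) p).source ∧
      extChartAt (𝓡 4) p q ∈ Metric.ball (extChartAt (𝓡 4) p p) r :=
    Filter.Eventually.and (extChartAt_source_mem_nhds p)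
      ((continuousAt_extChartAt p).eventually (Metric.ball_mem_nhds _ hr))
  refine ⟨ε, hε, (eventually_eventually_nhds.2 hV).mono fun q hq t ht => ?_⟩
  have ht' : t ∈ Ioo (-ε) ε := ⟨by linarith [ht.1], ht.2⟩
  have hflow : ∀ᶠ z in 𝓝 q,
      FlowsTo X t z ((extChartAt (𝓡 4) p).symm (α (extChartAt (𝓡 4) p z) t)) := by
    filter_upwards [hq] with z hz
    obtain ⟨h0, h1, -⟩ := hα _ hz.2
    refine ⟨fun s => (extChartAt (𝓡 4) p).symm (α (extChartAt (𝓡 4) p z) s), ?_, rfl, -ε, ε,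
      ⟨by linarith, hε⟩, ht', isMIntegralCurveOn_of_hasMFDerivAt fun s hs =>
        hasMFDerivAt_extChartAt_symm_comp (h1 s hs).1 (h1 s hs).2⟩
    simp only [h0]
    exact (extChartAt (𝓡 4) p).left_inv hz.1
  refine ⟨hflow.mono fun z hz => by rwa [hz.flowMap_eq hX], ?_⟩
  have hqs := hq.self_of_nhds
  obtain ⟨-, h1, h2⟩ := hα _ hqs.2
  have hd : MDifferentiableAt (𝓡 4) (𝓡 4)
      (fun z => (extChartAt (𝓡 4) p).symm (α (extChartAt (𝓡 4) p z) t)) q :=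
    (mdifferentiableAt_extChartAt_symm_of_mem (h1 t ht').2).comp q
      ((h2 t ht).mdifferentiableAt.comp q
        (mdifferentiableAt_extChartAt (by rw [← extChartAt_source (𝓡 4)]; exact hqs.1)))
  exact hd.congr_of_eventuallyEq (hflow.mono fun z hz => hz.flowMap_eq hX)

theorem IsCompact.exists_flowDifferentiableAt
    (hX : ∀ p, ContDiffAt ℝ 1 (chartField X p) (extChartAt (𝓡 4) p p)) {K : Set M}
    (hK : IsCompact K) :
    ∃ ε > 0, ∀ q ∈ K, ∀ t ∈ Ico 0 ε, FlowDifferentiableAt X t q := by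
  refine hK.induction_on (p := fun K => ∃ ε > 0, ∀ q ∈ K, ∀ t ∈ Ico 0 ε,
    FlowDifferentiableAt X t q) ⟨1, one_pos, by simp⟩ ?_ ?_ ?_
  · rintro A B hAB ⟨ε, hε, h⟩
    exact ⟨ε, hε, fun q hq => h q (hAB hq)⟩
  · rintro A B ⟨ε, hε, h⟩ ⟨δ, hδ, k⟩
    refine ⟨min ε δ, lt_min hε hδ, fun q hq t ht => hq.elim (fun hq => ?_) fun hq => ?_⟩
    · exact h q hq t ⟨ht.1, ht.2.trans_le (min_le_left _ _)⟩
    · exact k q hq t ⟨ht.1, ht.2.trans_le (min_le_right _ _)⟩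
  · intro p _
    obtain ⟨ε, hε, h⟩ := eventually_flowDifferentiableAt hX p
    exact ⟨_, mem_nhdsWithin_of_mem_nhds h, ε, hε, fun q hq => hq⟩

/-- The flow of a `C¹` vector field is defined on an open set of initial points and differentiable
there. -/
theorem FlowsTo.flowDifferentiableAt
    (hX : ∀ p, ContDiffAt ℝ 1 (chartField X p) (extChartAt (𝓡 4) p p)) (ht : 0 ≤ t)
    (h : FlowsTo X t x y) : FlowDifferentiableAt X t x := by
  obtain ⟨γ, h0, -, a, b, h0m, htm, hγ⟩ := h
  have hsub : Icc 0 t ⊆ Ioo a b := fun u hu => ⟨h0m.1.trans_le hu.1, hu.2.trans_lt htm.2⟩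
  obtain ⟨ε, hε, hnice⟩ := IsCompact.exists_flowDifferentiableAt hX
    (isCompact_Icc.image_of_continuousOn (hγ.continuousOn.mono hsub))
  obtain ⟨n, hn⟩ := exists_nat_gt (t / ε)
  have hn0 : (0 : ℝ) < n := (div_nonneg ht hε.le).trans_lt hn
  set δ := t / n with hδ
  have hδ0 : 0 ≤ δ := div_nonneg ht hn0.le
  have hδε : δ < ε := by
    rw [hδ, div_lt_iff₀ hn0]; rw [div_lt_iff₀ hε] at hn; linarith
  have hnδ : n * δ = t := by rw [hδ]; field_simp
  have hmem : ∀ i : ℕ, i ≤ n → (i * δ : ℝ) ∈ Icc 0 t := fun i hi =>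
    ⟨by positivity, by rw [← hnδ]; gcongr⟩
  have key : ∀ i : ℕ, i ≤ n → FlowDifferentiableAt X (i * δ) x := by
    intro i
    induction i with
    | zero =>
      intro _
      simpa [h0] using hnice (γ 0) (mem_image_of_mem _ (left_mem_Icc.2 ht)) 0 ⟨le_rfl, hε⟩
    | succ i ih =>
      intro hi
      have hi' : i ≤ n := (Nat.le_succ i).trans hi
      have hflow : FlowsTo X (i * δ) x (γ (i * δ)) :=
        ⟨γ, h0, rfl, a, b, h0m, hsub (hmem i hi'), hγ⟩
      have := FlowDifferentiableAt.add hX (ih hi') (t := δ) (by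
        rw [hflow.flowMap_eq hX]
        exact hnice _ (mem_image_of_mem _ (hmem i hi')) δ ⟨hδ0, hδε⟩)
      rwa [Nat.cast_succ, add_mul, one_mul]
  simpa [hnδ] using key n le_rfl

end Flow

section ReversibleLinearMaps

theorem LinearMap.trace_mul_self_of_finrank_eq_two {Q : Type*} [AddCommGroup Q] [Module ℝ Q]
    (hQ : Module.finrank ℝ Q = 2) (B : Q →ₗ[ℝ] Q) :
    LinearMap.trace ℝ Q (B * B) = LinearMap.trace ℝ Q B ^ 2 - 2 * LinearMap.det B := by
  have : FiniteDimensional ℝ Q := Module.finite_of_finrank_eq_succ hQ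
  let b := Module.finBasisOfFinrankEq ℝ Q hQ
  rw [LinearMap.trace_eq_matrix_trace ℝ b, LinearMap.trace_eq_matrix_trace ℝ b,
    ← LinearMap.det_toMatrix b, LinearMap.toMatrix_mul, Matrix.trace_fin_two,
    Matrix.trace_fin_two, Matrix.det_fin_two, Matrix.mul_apply, Matrix.mul_apply,
    Fin.sum_univ_two, Fin.sum_univ_two]
  ring

theorem LinearMap.neg_two_le_trace_pow_of_reversible {Q : Type*} [AddCommGroup Q] [Module ℝ Q]
    (hQ : Module.finrank ℝ Q = 2) {N R : Q →ₗ[ℝ] Q} (hNRN : N * R * N = R) (hRR : R * R = 1)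
    (m : ℕ) : -2 ≤ LinearMap.trace ℝ Q (N ^ (2 * m)) := by
  have hR : LinearMap.det R * LinearMap.det R = 1 := by rw [← map_mul, hRR, map_one]
  have hN : LinearMap.det N ^ 2 = 1 := by
    have h := congrArg LinearMap.det hNRN
    rw [map_mul, map_mul] at h
    linear_combination LinearMap.det R * h + (1 - LinearMap.det N ^ 2) * hR
  have hB : LinearMap.det (N ^ m) ^ 2 = 1 := by
    rw [map_pow, ← pow_mul, mul_comm m 2, pow_mul, hN, one_pow]
  rw [two_mul, pow_add, LinearMap.trace_mul_self_of_finrank_eq_two hQ]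
  nlinarith [sq_nonneg (LinearMap.trace ℝ Q (N ^ m)), sq_nonneg (LinearMap.det (N ^ m) - 1)]

variable {V : Type*} [AddCommGroup V] [Module ℝ V] {K : Submodule ℝ V} {l : Submodule ℝ K}

theorem Submodule.mapQ_restrict_iterate {N : V →ₗ[ℝ] V} (hN : ∀ w ∈ K, N w ∈ K)
    (hNl : l ≤ l.comap (N.restrict hN)) (j : ℕ) (w : K) :
    ∃ hw : N^[j] w ∈ K,
      (l.mapQ l (N.restrict hN) hNl ^ j) (Submodule.Quotient.mk w)
        = Submodule.Quotient.mk ⟨N^[j] w, hw⟩ := by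
  induction j with
  | zero => exact ⟨w.2, rfl⟩
  | succ j ih =>
    obtain ⟨hw, h⟩ := ih
    refine ⟨by rw [Function.iterate_succ_apply']; exact hN _ hw, ?_⟩
    rw [pow_succ', Module.End.mul_apply, h, Submodule.mapQ_apply]
    congr 1
    ext
    simp [Function.iterate_succ_apply']

theorem LinearMap.neg_two_le_trace_quotient_of_reversible
    (hQ : Module.finrank ℝ (K ⧸ l) = 2) {N R : V →ₗ[ℝ] V}
    (hN : ∀ w ∈ K, N w ∈ K) (hNl : l ≤ l.comap (N.restrict hN))
    (hR : ∀ w ∈ K, R w ∈ K) (hRl : l ≤ l.comap (R.restrict hR))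
    (hNRN : ∀ w, N (R (N w)) = R w) (hRR : ∀ w, R (R w) = w) (m : ℕ)
    {A : (K ⧸ l) →ₗ[ℝ] (K ⧸ l)}
    (hA : ∀ w : K, ∃ hw : N^[2 * m] w ∈ K,
      A (Submodule.Quotient.mk w) = Submodule.Quotient.mk ⟨N^[2 * m] w, hw⟩) :
    -2 ≤ LinearMap.trace ℝ (K ⧸ l) A := by
  have hAN : A = l.mapQ l (N.restrict hN) hNl ^ (2 * m) := by
    refine Submodule.linearMap_qext _ (LinearMap.ext fun w => ?_)
    obtain ⟨hw, h⟩ := hA w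
    obtain ⟨hw', h'⟩ := Submodule.mapQ_restrict_iterate hN hNl (2 * m) w
    exact h.trans h'.symm
  rw [hAN]
  refine LinearMap.neg_two_le_trace_pow_of_reversible hQ (R := l.mapQ l (R.restrict hR) hRl) ?_ ?_ m
  · refine Submodule.linearMap_qext _ (LinearMap.ext fun w => ?_)
    exact congrArg Submodule.Quotient.mk (Subtype.ext (hNRN w))
  · refine Submodule.linearMap_qext _ (LinearMap.ext fun w => ?_)
    exact congrArg Submodule.Quotient.mk (Subtype.ext (hRR w))

end ReversibleLinearMaps

section SymmetricFlow

variable {M : Type*} [TopologicalSpace M] [ChartedSpace R4 M]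

theorem HasMFDerivAt.comp_of_fixed {f g : M → M} {x : M} {f' g' : R4 →L[ℝ] R4} (hx : f x = x)
    (hg : HasMFDerivAt (𝓡 4) (𝓡 4) g x g') (hf : HasMFDerivAt (𝓡 4) (𝓡 4) f x f') :
    HasMFDerivAt (𝓡 4) (𝓡 4) (g ∘ f) x (g'.comp f') := by
  have h : ∀ y, y = x → HasMFDerivAt (𝓡 4) (𝓡 4) g y g' := by
    rintro _ rfl
    exact hg
  exact HasMFDerivAt.comp x (h _ hx) hf

theorem HasMFDerivAt.iterate_of_fixed {f : M → M} {x : M} {f' : R4 →L[ℝ] R4} (hx : f x = x)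
    (hf : HasMFDerivAt (𝓡 4) (𝓡 4) f x f') (j : ℕ) :
    HasMFDerivAt (𝓡 4) (𝓡 4) f^[j] x (f' ^ j) := by
  induction j with
  | zero => exact hasMFDerivAt_id x
  | succ j ih =>
    rw [Function.iterate_succ', pow_succ']
    exact HasMFDerivAt.comp_of_fixed (Function.iterate_fixed hx j) hf ih

theorem mfderiv_mfderiv_of_involutive {ρ : M → M} (hρ : MDifferentiable (𝓡 4) (𝓡 4) ρ)
    (hinv : Function.Involutive ρ) {x y : M} (hxy : ρ x = y) (w : R4) :
    (mfderiv (𝓡 4) (𝓡 4) ρ y (mfderiv (𝓡 4) (𝓡 4) ρ x w : R4) : R4) = w := by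
  subst hxy
  have h := mfderiv_comp x (hρ (ρ x)) (hρ x)
  have h2 : mfderiv (𝓡 4) (𝓡 4) (ρ ∘ ρ) x = ContinuousLinearMap.id ℝ R4 := by
    rw [hinv.comp_self]
    exact mfderiv_id
  exact (congrArg (fun A : R4 →L[ℝ] R4 => A w) (h.symm.trans h2) :)

variable [T2Space M] [IsManifold (𝓡 4) 1 M] {X : ∀ x : M, TangentSpace (𝓡 4) x}

/-- If an involutive symmetry `σ` of the flow of `X` satisfies `φ^T(x) = σ(x)`, then `σ ∘ φ^T` is
near `x` a square root of the return map `φ^{2T}`. -/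
theorem eventually_flowsTo_iterate
    (hX : ∀ p, ContDiffAt ℝ 1 (chartField X p) (extChartAt (𝓡 4) p p)) {σ : M → M}
    (hσi : Function.Involutive σ) (hσc : Continuous σ)
    (hσX : ∀ t x y, FlowsTo X t x y → FlowsTo X t (σ x) (σ y)) {T : ℝ} (hT : 0 ≤ T) {x : M}
    (hx : FlowsTo X T x (σ x)) (j : ℕ) :
    ∀ᶠ q in 𝓝 x, FlowsTo X (j * T) q (σ^[j] ((fun z => σ (flowMap X T z))^[j] q)) := by
  have hd := hx.flowDifferentiableAt hX hT
  have hnx : σ (flowMap X T x) = x := by rw [hx.flowMap_eq hX, hσi x]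
  have hnc : ContinuousAt (fun z => σ (flowMap X T z)) x :=
    hσc.continuousAt.comp hd.2.continuousAt
  have hsymm : ∀ (i : ℕ) (t : ℝ) (y z : M), FlowsTo X t y z → FlowsTo X t (σ^[i] y) (σ^[i] z) := by
    intro i
    induction i with
    | zero => exact fun t y z h => h
    | succ i ih => exact fun t y z h => ih t _ _ (hσX t y z h)
  have hnj : ∀ i : ℕ, Filter.Tendsto ((fun z => σ (flowMap X T z))^[i]) (𝓝 x) (𝓝 x) := by
    intro i
    have h := hnc.iterate hnx i
    have h2 : (fun z => σ (flowMap X T z))^[i] x = x := Function.iterate_fixed hnx i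
    simpa only [ContinuousAt, h2] using h
  induction j with
  | zero =>
    have h0 : FlowsTo X 0 x x := by
      obtain ⟨γ, h0, -, a, b, h0m, -, hγ⟩ := hx
      exact ⟨γ, h0, h0, a, b, h0m, h0m, hγ⟩
    filter_upwards [(h0.flowDifferentiableAt hX le_rfl).1] with q hq
    obtain ⟨γ, h0, -, a, b, h0m, -, hγ⟩ := hq
    rw [Nat.cast_zero, zero_mul]
    exact ⟨γ, h0, h0, a, b, h0m, h0m, hγ⟩
  | succ j ih =>
    filter_upwards [ih, (hnj j).eventually hd.1] with q h1 h2
    have h3 := h1.trans hX (hsymm j _ _ _ h2)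
    rw [Nat.cast_succ, add_mul, one_mul, Function.iterate_succ_apply' (fun z => σ (flowMap X T z)),
      Function.iterate_succ_apply σ, hσi]
    exact h3

theorem eventually_flowMap_eq_iterate
    (hX : ∀ p, ContDiffAt ℝ 1 (chartField X p) (extChartAt (𝓡 4) p p)) {σ : M → M}
    (hσi : Function.Involutive σ) (hσc : Continuous σ)
    (hσX : ∀ t x y, FlowsTo X t x y → FlowsTo X t (σ x) (σ y)) {T : ℝ} (hT : 0 ≤ T) {x : M}
    (hx : FlowsTo X T x (σ x)) (m : ℕ) :
    ∀ᶠ q in 𝓝 x, flowMap X (m * (2 * T)) q = (fun z => σ (flowMap X T z))^[2 * m] q := by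
  filter_upwards [eventually_flowsTo_iterate hX hσi hσc hσX hT hx (2 * m)] with q hq
  have h : ((2 * m : ℕ) : ℝ) * T = m * (2 * T) := by push_cast; ring
  have hσm : σ^[2 * m] = id := by
    rw [Function.iterate_mul, Function.iterate_succ, Function.iterate_one, hσi.comp_self,
      Function.iterate_id]
  rw [h, hσm] at hq
  exact hq.flowMap_eq hX

end SymmetricFlow

section HamiltonianSymmetries

variable {M : Type*} [TopologicalSpace M] [ChartedSpace R4 M]

theorem ContinuousAlternatingMap.apply_two_neg_right {E : Type*} [NormedAddCommGroup E]
    [NormedSpace ℝ E] (η : E [⋀^Fin 2]→L[ℝ] ℝ) (u w : E) : η ![u, -w] = -η ![u, w] := by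
  rw [← curryTwoForm_apply, ← curryTwoForm_apply, map_neg]

theorem mfderiv_hamiltonianVectorField_self (Ω : SymplecticForm M) (H : M → ℝ) (x : M) :
    mfderiv (𝓡 4) 𝓘(ℝ, ℝ) H x (hamiltonianVectorField Ω H x) = (0 : ℝ) :=
  (hamiltonianVectorField_spec Ω H x _).trans
    ((Ω.form x).map_eq_zero_of_eq _ (i := 0) (j := 1) rfl (by decide))

/-- The Hamiltonian vector field vanishes only where the differential of the Hamiltonian does. -/
theorem hamiltonianVectorField_eq_zero (Ω : SymplecticForm M) {H : M → ℝ} {x : M}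
    (h : ∀ w : TangentSpace (𝓡 4) x, mfderiv (𝓡 4) 𝓘(ℝ, ℝ) H x w = (0 : ℝ)) :
    hamiltonianVectorField Ω H x = 0 := by
  refine Ω.nondegenerate x _ fun w => ?_
  refine (ContinuousAlternatingMap.apply_two_swap (E := R4) (Ω.form x) _ w).trans ?_
  exact neg_eq_zero.2 ((hamiltonianVectorField_spec Ω H x w).symm.trans (h w))

theorem mfderiv_comp_symmetry {H : M → ℝ} (hH : MDifferentiable (𝓡 4) 𝓘(ℝ, ℝ) H) {ρ : M → M}
    {x : M} (hρ : MDifferentiableAt (𝓡 4) (𝓡 4) ρ x) (hHρ : ∀ᶠ z in 𝓝 x, H (ρ z) = H z)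
    (w : TangentSpace (𝓡 4) x) :
    mfderiv (𝓡 4) 𝓘(ℝ, ℝ) H (ρ x) (mfderiv (𝓡 4) (𝓡 4) ρ x w)
      = mfderiv (𝓡 4) 𝓘(ℝ, ℝ) H x w := by
  have h1 := mfderiv_comp x (hH (ρ x)) hρ
  have h2 : H ∘ ρ =ᶠ[𝓝 x] H := hHρ
  have h3 := h2.mfderiv_eq (I := 𝓡 4) (I' := 𝓘(ℝ, ℝ))
  exact (congrArg (fun A : R4 →L[ℝ] ℝ => A w) (h1.symm.trans h3) :)

theorem IsAntisymplecticInvolution.mfderiv_hamiltonianVectorField {Ω : SymplecticForm M}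
    {ρ : M → M} (hρ : IsAntisymplecticInvolution Ω ρ) {H : M → ℝ}
    (hH : MDifferentiable (𝓡 4) 𝓘(ℝ, ℝ) H) (hHρ : H ∘ ρ = H) (x : M) :
    mfderiv (𝓡 4) (𝓡 4) ρ x (hamiltonianVectorField Ω H x)
      = -hamiltonianVectorField Ω H (ρ x) := by
  have hρd : MDifferentiable (𝓡 4) (𝓡 4) ρ := hρ.smooth.mdifferentiable (by simp)
  have h := (Ω.existsUnique_dual (ρ x) (mfderiv (𝓡 4) 𝓘(ℝ, ℝ) H (ρ x))).unique
    (y₁ := hamiltonianVectorField Ω H (ρ x))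
    (y₂ := -mfderiv (𝓡 4) (𝓡 4) ρ x (hamiltonianVectorField Ω H x))
    (fun w => hamiltonianVectorField_spec Ω H (ρ x) w) (fun w => ?_)
  · rw [h, neg_neg]
  · obtain ⟨u, rfl⟩ : ∃ u : TangentSpace (𝓡 4) x, mfderiv (𝓡 4) (𝓡 4) ρ x u = w :=
      ⟨_, mfderiv_mfderiv_of_involutive hρd hρ.involutive (hρ.involutive x) w⟩
    refine Eq.trans ?_
      (ContinuousAlternatingMap.apply_two_neg_right (E := R4) (Ω.form (ρ x)) _ _).symm
    refine Eq.trans ?_ (congrArg Neg.neg (hρ.pullback x u (hamiltonianVectorField Ω H x))).symm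
    rw [neg_neg, ← hamiltonianVectorField_spec]
    exact mfderiv_comp_symmetry hH (hρd x) (.of_forall (congrFun hHρ)) u

theorem finrank_reducedTangent (Ω : SymplecticForm M) {H : M → ℝ} {x : M}
    (hx : hamiltonianVectorField Ω H x ≠ 0) :
    Module.finrank ℝ (ReducedTangent Ω H x) = 2 := by
  have hfd : FiniteDimensional ℝ (TangentSpace (𝓡 4) x) :=
    inferInstanceAs (FiniteDimensional ℝ R4)
  have h4 : Module.finrank ℝ (TangentSpace (𝓡 4) x) = 4 :=
    (finrank_euclideanSpace_fin (𝕜 := ℝ) (n := 4) :)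
  set dH : TangentSpace (𝓡 4) x →ₗ[ℝ] ℝ :=
    (mfderiv (𝓡 4) 𝓘(ℝ, ℝ) H x : TangentSpace (𝓡 4) x →L[ℝ] ℝ).toLinearMap with hdH
  have hne : dH ≠ 0 := fun h =>
    hx (hamiltonianVectorField_eq_zero Ω fun w => LinearMap.congr_fun h w)
  have hrange : Module.finrank ℝ (LinearMap.range dH) = 1 := by
    rw [LinearMap.range_eq_top.2 (LinearMap.surjective hne), finrank_top, Module.finrank_self]
  have hker : Module.finrank ℝ (levelTangent H x) + 1 = 4 := by
    have h := dH.finrank_range_add_finrank_ker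
    rw [hrange, h4] at h
    change Module.finrank ℝ (LinearMap.ker dH) + 1 = 4
    omega
  have hmem : Submodule.span ℝ {hamiltonianVectorField Ω H x} ≤ levelTangent H x := by
    rw [Submodule.span_singleton_le_iff_mem]
    exact mfderiv_hamiltonianVectorField_self Ω H x
  have hline : Module.finrank ℝ (hamiltonianLine Ω H x) = 1 := by
    rw [hamiltonianLine, (Submodule.submoduleOfEquivOfLe hmem).finrank_eq,
      finrank_span_singleton hx]
  have hq := (hamiltonianLine Ω H x).finrank_quotient_add_finrank
  change Module.finrank ℝ (levelTangent H x ⧸ hamiltonianLine Ω H x) = 2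
  omega

theorem hamiltonianLine_le_comap (Ω : SymplecticForm M) {H : M → ℝ} {x : M}
    {N : TangentSpace (𝓡 4) x →ₗ[ℝ] TangentSpace (𝓡 4) x}
    (hN : ∀ w ∈ levelTangent H x, N w ∈ levelTangent H x) {c : ℝ}
    (hNX : N (hamiltonianVectorField Ω H x) = c • hamiltonianVectorField Ω H x) :
    hamiltonianLine Ω H x ≤ (hamiltonianLine Ω H x).comap (N.restrict hN) := by
  intro w hw
  obtain ⟨a, ha⟩ := Submodule.mem_span_singleton.1 (Submodule.mem_comap.1 hw)
  refine Submodule.mem_comap.2 (Submodule.mem_comap.2 (Submodule.mem_span_singleton.2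
    ⟨a * c, ?_⟩))
  have h : N (w : TangentSpace (𝓡 4) x) = (a * c) • hamiltonianVectorField Ω H x := by
    rw [mul_smul, ← hNX, ← map_smul]
    exact congrArg N ha.symm
  exact h.symm

end HamiltonianSymmetries

section ReturnMap

variable {M : Type*} [TopologicalSpace M] [ChartedSpace R4 M]

/-- `N` is a linear map for which `N ^ 2` is the differential at `x` of the return map of period
`2 * T`, and which is conjugated to its inverse by the linear involution `R`; both induce maps of
`T_x Σ / ⟨X_H(x)⟩`. -/
structure IsReversibleRoot (Ω : SymplecticForm M) (H : M → ℝ) (x : M) (T : ℝ)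
    (N R : TangentSpace (𝓡 4) x →L[ℝ] TangentSpace (𝓡 4) x) : Prop where
  flowMap_eq : ∀ m : ℕ, flowMap (hamiltonianVectorField Ω H) (m * (2 * T)) x = x
  hasMFDerivAt : ∀ m : ℕ, ∃ D : TangentSpace (𝓡 4) x →L[ℝ] TangentSpace (𝓡 4) x,
    HasMFDerivAt (𝓡 4) (𝓡 4) (flowMap (hamiltonianVectorField Ω H) (m * (2 * T))) x D ∧
      ∀ w, D w = N^[2 * m] w
  map_mem : ∀ w ∈ levelTangent H x, N w ∈ levelTangent H x
  map_field : N (hamiltonianVectorField Ω H x) = hamiltonianVectorField Ω H x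
  reversor_mem : ∀ w ∈ levelTangent H x, R w ∈ levelTangent H x
  reversor_field : R (hamiltonianVectorField Ω H x) = -hamiltonianVectorField Ω H x
  map_reversor_map : ∀ w, N (R (N w)) = R w
  reversor_reversor : ∀ w, R (R w) = w

variable {Ω : SymplecticForm M} {H : M → ℝ} {x : M} {T : ℝ}

theorem IsReversibleRoot.neg_two_le_trace
    {N R : TangentSpace (𝓡 4) x →L[ℝ] TangentSpace (𝓡 4) x}
    (h : IsReversibleRoot Ω H x T N R) (hx : hamiltonianVectorField Ω H x ≠ 0) (m : ℕ)
    {w : UnitAddCircle → M} (hw : w 0 = x)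
    {A : ReducedTangent Ω H (w 0) →ₗ[ℝ] ReducedTangent Ω H (w 0)}
    (hA : IsReducedMonodromy Ω H w (m * (2 * T)) A) :
    -2 ≤ LinearMap.trace ℝ (ReducedTangent Ω H (w 0)) A := by
  subst hw
  obtain ⟨-, D, hD, hDA⟩ := hA
  obtain ⟨D', hD', hDN⟩ := h.hasMFDerivAt m
  have hDD : D = D' := hasMFDerivAt_unique hD hD'
  refine LinearMap.neg_two_le_trace_quotient_of_reversible (finrank_reducedTangent Ω hx)
    (N := N.toLinearMap) (R := R.toLinearMap) h.map_mem
    (hamiltonianLine_le_comap Ω (c := 1) h.map_mem (by rw [one_smul]; exact h.map_field))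
    h.reversor_mem
    (hamiltonianLine_le_comap Ω (c := -1) h.reversor_mem
      (by rw [neg_one_smul]; exact h.reversor_field))
    h.map_reversor_map h.reversor_reversor m fun u => ?_
  obtain ⟨hu, hAu⟩ := hDA u
  have e : D u = N^[2 * m] u := by rw [hDD, hDN]
  have hu' : N^[2 * m] u ∈ levelTangent H (w 0) := e ▸ hu
  exact ⟨hu', hAu.trans (congrArg Submodule.Quotient.mk (Subtype.ext e))⟩

theorem IsReversibleRoot.existsUnique_reducedMonodromy {v : UnitAddCircle → M}
    {N R : TangentSpace (𝓡 4) (v 0) →L[ℝ] TangentSpace (𝓡 4) (v 0)}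
    (h : IsReversibleRoot Ω H (v 0) T N R) :
    ∃! A : ReducedTangent Ω H (v 0) →ₗ[ℝ] ReducedTangent Ω H (v 0),
      IsReducedMonodromy Ω H v (2 * T) A := by
  obtain ⟨D, hD, hDN⟩ := h.hasMFDerivAt 1
  have hflow := h.flowMap_eq 1
  rw [Nat.cast_one, one_mul] at hD hflow
  have hl := hamiltonianLine_le_comap Ω (N := N.toLinearMap) (c := 1) h.map_mem
    (by rw [one_smul]; exact h.map_field)
  refine ⟨(hamiltonianLine Ω H (v 0)).mapQ (hamiltonianLine Ω H (v 0))
    (N.toLinearMap.restrict h.map_mem) hl ^ 2, ⟨hflow, D, hD, fun w => ?_⟩, ?_⟩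
  · obtain ⟨hw, hA⟩ := Submodule.mapQ_restrict_iterate (N := N.toLinearMap) h.map_mem hl 2 w
    have e : D w = N^[2] w := hDN w
    have hw' : D w ∈ levelTangent H (v 0) := by rw [e]; exact hw
    exact ⟨hw', hA.trans (congrArg Submodule.Quotient.mk (Subtype.ext e.symm))⟩
  · rintro B ⟨-, D', hD', hB⟩
    have hDD : D' = D := hasMFDerivAt_unique hD' hD
    refine Submodule.linearMap_qext _ (LinearMap.ext fun w => ?_)
    obtain ⟨hw, hA⟩ := Submodule.mapQ_restrict_iterate (N := N.toLinearMap) h.map_mem hl 2 w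
    obtain ⟨hw', hB'⟩ := hB w
    have e : D' w = N^[2] w := by rw [hDD]; exact hDN w
    exact hB'.trans ((congrArg Submodule.Quotient.mk (Subtype.ext e)).trans hA.symm)

variable [T2Space M] [IsManifold (𝓡 4) 1 M]

/-- The differential of `σ ∘ φ^T` is a reversible root of the differential of the return map along
an orbit with `σ(γ(s)) = γ(s + T)` that passes through a fixed point of `ρ`. -/
theorem exists_isReversibleRoot (hH : MDifferentiable (𝓡 4) 𝓘(ℝ, ℝ) H)
    (hX : ∀ p, ContDiffAt ℝ 1 (chartField (hamiltonianVectorField Ω H) p) (extChartAt (𝓡 4) p p))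
    {ρ σ : M → M} (hρ : IsAntisymplecticInvolution Ω ρ) (hHρ : H ∘ ρ = H)
    (hσd : MDifferentiable (𝓡 4) (𝓡 4) σ) (hσi : Function.Involutive σ) (hHσ : H ∘ σ = H)
    (hσρ : Function.Commute σ ρ)
    (hσX : ∀ t x y, FlowsTo (hamiltonianVectorField Ω H) t x y →
      FlowsTo (hamiltonianVectorField Ω H) t (σ x) (σ y))
    (hT : 0 ≤ T) {γ : ℝ → M} (hγ : IsMIntegralCurve γ (hamiltonianVectorField Ω H))
    (hγσ : ∀ s, σ (γ s) = γ (s + T)) (hγρ : ρ (γ 0) = γ 0) :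
    ∃ N R, IsReversibleRoot Ω H (γ 0) T N R := by
  set X := hamiltonianVectorField Ω H with hXdef
  have hρd : MDifferentiable (𝓡 4) (𝓡 4) ρ := hρ.smooth.mdifferentiable (by simp)
  have hflow : ∀ s, FlowsTo X T (γ s) (σ (γ s)) := fun s => by
    rw [hγσ]; exact hγ.flowsTo s T
  have hd := (hflow 0).flowDifferentiableAt hX hT
  set n : M → M := fun z => σ (flowMap X T z) with hn
  have hnγ : ∀ s, n (γ s) = γ s := fun s => by
    rw [hn]; simp only; rw [(hflow s).flowMap_eq hX, hσi]
  have hnd : MDifferentiableAt (𝓡 4) (𝓡 4) n (γ 0) := (hσd _).comp _ hd.2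
  obtain ⟨N, hN⟩ : ∃ N : R4 →L[ℝ] R4, HasMFDerivAt (𝓡 4) (𝓡 4) n (γ 0) N :=
    ⟨_, hnd.hasMFDerivAt⟩
  obtain ⟨R, hR⟩ : ∃ R : R4 →L[ℝ] R4, HasMFDerivAt (𝓡 4) (𝓡 4) ρ (γ 0) R :=
    ⟨_, (hρd _).hasMFDerivAt⟩
  have hHX := mfderiv_hamiltonianVectorField_self Ω H
  have hHn : ∀ᶠ z in 𝓝 (γ 0), H (n z) = H z := hd.1.mono fun z hz =>
    (congrFun hHσ _).trans (hz.apply_eq hH hHX)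
  have hlevel : ∀ {f : M → M} {F : R4 →L[ℝ] R4}, HasMFDerivAt (𝓡 4) (𝓡 4) f (γ 0) F →
      f (γ 0) = γ 0 → (∀ᶠ z in 𝓝 (γ 0), H (f z) = H z) →
      ∀ w ∈ levelTangent H (γ 0), (F w : TangentSpace (𝓡 4) (γ 0)) ∈ levelTangent H (γ 0) := by
    intro f F hF hfix hHf w hw
    have h1 := mfderiv_comp_symmetry hH hF.mdifferentiableAt hHf w
    rw [hF.mfderiv, hfix] at h1
    exact h1.trans hw
  have hnρn : ∀ᶠ z in 𝓝 (γ 0), (n ∘ ρ ∘ n) z = ρ z := hd.1.mono fun z hz => by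
    have h1 : FlowsTo X T (ρ (flowMap X T z)) (ρ z) :=
      hz.map_of_neg hρd (hρ.mfderiv_hamiltonianVectorField hH hHρ)
    have h2 := hσX _ _ _ h1
    change σ (flowMap X T (ρ (σ (flowMap X T z)))) = ρ z
    rw [← hσρ.eq, h2.flowMap_eq hX, hσi]
  have hNX : N (X (γ 0)) = X (γ 0) := by
    have hγ0 := hγ 0
    have h1 := HasMFDerivAt.comp (0 : ℝ) (f := γ) (g := n) hN hγ0
    have h2 : n ∘ γ = γ := funext hnγ
    rw [h2] at h1
    have h3 := hasMFDerivAt_unique h1 hγ0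
    have h4 := congrArg (fun A : ℝ →L[ℝ] R4 => A 1) h3
    change N ((1 : ℝ) • X (γ 0)) = (1 : ℝ) • X (γ 0) at h4
    rwa [one_smul] at h4
  have hRX : R (X (γ 0)) = -X (γ 0) := by
    have h := hρ.mfderiv_hamiltonianVectorField hH hHρ (γ 0)
    rwa [hR.mfderiv, hγρ] at h
  refine ⟨N, R, ?_, ?_, hlevel hN (hnγ 0) hHn, hNX, hlevel hR hγρ (.of_forall (congrFun hHρ)),
    hRX, fun w => ?_, fun w => ?_⟩
  · intro m
    rw [(eventually_flowMap_eq_iterate hX hσi hσd.continuous hσX hT (hflow 0) m).self_of_nhds]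
    exact Function.iterate_fixed (hnγ 0) _
  · intro m
    refine ⟨N ^ (2 * m), ?_, fun w => ?_⟩
    · exact (HasMFDerivAt.iterate_of_fixed (hnγ 0) hN (2 * m)).congr_of_eventuallyEq
        (eventually_flowMap_eq_iterate hX hσi hσd.continuous hσX hT (hflow 0) m)
    · exact congrFun (FunLike.coe_pow_eq_iterate N (2 * m)) w
  · have hρn : (ρ ∘ n) (γ 0) = γ 0 := by rw [Function.comp_apply, hnγ, hγρ]
    have h1 := HasMFDerivAt.comp_of_fixed hρn hN (HasMFDerivAt.comp_of_fixed (hnγ 0) hR hN)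
    have h2 := hasMFDerivAt_unique (hR.congr_of_eventuallyEq hnρn) h1
    exact congrArg (fun A : R4 →L[ℝ] R4 => A w) h2.symm
  · have h := mfderiv_mfderiv_of_involutive hρd hρ.involutive hγρ w
    rwa [hR.mfderiv] at h

end ReturnMap

section DoublySymmetric

variable {M : Type*} [TopologicalSpace M] [ChartedSpace R4 M] {Ω : SymplecticForm M} {H : M → ℝ}
  {ρ₁ ρ₂ : M → M} {v : UnitAddCircle → M} {τ : ℝ}

theorem IsSimplePeriodicOrbit.apply_zero_ne_apply_half (hv : IsSimplePeriodicOrbit Ω H v τ) :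
    v 0 ≠ v ((1 / 2 : ℝ) : UnitAddCircle) := by
  intro h
  obtain ⟨n, hn⟩ := (AddCircle.coe_eq_zero_iff (1 : ℝ)).1 (hv.injective h).symm
  have h2 : (2 * n : ℝ) = 1 := by
    rw [zsmul_eq_mul, mul_one] at hn
    rw [hn]; norm_num
  have h3 : 2 * n = 1 := by exact_mod_cast h2
  omega

/-- The parametrization by physical time of a periodic orbit. -/
theorem IsPeriodicOrbit.isMIntegralCurve (hv : IsPeriodicOrbit Ω H v τ) :
    IsMIntegralCurve (fun s : ℝ => v ((s * τ⁻¹ : ℝ) : UnitAddCircle))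
      (hamiltonianVectorField Ω H) := by
  have h := hv.ode.comp_mul τ⁻¹
  have e : (τ⁻¹ • fun x => τ • hamiltonianVectorField Ω H x) = hamiltonianVectorField Ω H := by
    ext1 x
    rw [Pi.smul_apply, smul_smul, inv_mul_cancel₀ hv.period_pos.ne', one_smul]
  rwa [e] at h

theorem IsSimplePeriodicOrbit.isPeriodicOrbit_coverLoop (hv : IsSimplePeriodicOrbit Ω H v τ)
    {k : ℕ} (hk : 0 < k) : IsPeriodicOrbit Ω H (coverLoop k v) (k * τ) := by
  have hk0 : (0 : ℝ) < k := Nat.cast_pos.2 hk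
  refine ⟨mul_pos hk0 hv.period_pos, ?_, 0, ((1 / 2 / k : ℝ) : UnitAddCircle), ?_⟩
  · have h := hv.ode.comp_mul (k : ℝ)
    have e : ((k : ℝ) • fun x => τ • hamiltonianVectorField Ω H x)
        = fun x => (k * τ) • hamiltonianVectorField Ω H x := by
      ext1 x
      rw [Pi.smul_apply, smul_smul]
    have e2 : (fun t : ℝ => coverLoop k v (t : UnitAddCircle))
        = (fun t : ℝ => v (t : UnitAddCircle)) ∘ (· * (k : ℝ)) := by
      ext1 t
      rw [coverLoop, ← AddCircle.coe_nsmul, nsmul_eq_mul, mul_comm]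
      rfl
    rw [e] at h
    rwa [e2]
  · rw [coverLoop, coverLoop, smul_zero, ← AddCircle.coe_nsmul, nsmul_eq_mul,
      mul_div_cancel₀ _ hk0.ne']
    exact hv.apply_zero_ne_apply_half

/-- A periodic orbit with a cover in common with a simple periodic orbit is itself a cover of the
simple one. -/
theorem IsSimplePeriodicOrbit.exists_period_eq_of_coverLoop_eq
    (hv : IsSimplePeriodicOrbit Ω H v τ) {w : UnitAddCircle → M} {σ : ℝ} {k l : ℕ} (hl : 0 < l)
    (hcover : coverLoop k v = coverLoop l w) (hτ : k * τ = l * σ) :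
    w 0 = v 0 ∧ ∃ m : ℕ, σ = m * τ := by
  have hl0 : (0 : ℝ) < l := Nat.cast_pos.2 hl
  have h0 : w 0 = v 0 := by simpa [coverLoop] using (congrFun hcover 0).symm
  have h1 : v ((k / l : ℝ) : UnitAddCircle) = v 0 := by
    have h := congrFun hcover ((1 / l : ℝ) : UnitAddCircle)
    rw [coverLoop, coverLoop, ← AddCircle.coe_nsmul, ← AddCircle.coe_nsmul, nsmul_eq_mul,
      nsmul_eq_mul, mul_one_div, mul_one_div, div_self hl0.ne'] at h
    rw [h, ← h0]
    exact congrArg w (AddCircle.coe_period (1 : ℝ))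
  obtain ⟨n, hn⟩ := (AddCircle.coe_eq_zero_iff (1 : ℝ)).1 (hv.injective h1)
  rw [zsmul_eq_mul, mul_one] at hn
  have hn0 : 0 ≤ n := by
    have : (0 : ℝ) ≤ n := by rw [hn]; positivity
    exact_mod_cast this
  lift n to ℕ using hn0
  refine ⟨h0, n, ?_⟩
  rw [Int.cast_natCast, eq_div_iff hl0.ne'] at hn
  have h2 : (l : ℝ) * σ = l * (n * τ) := by rw [← hτ, ← hn]; ring
  exact mul_left_cancel₀ hl0.ne' h2

variable [T2Space M] [IsManifold (𝓡 4) 1 M]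

theorem IsSimplePeriodicOrbit.hamiltonianVectorField_ne_zero (hv : IsSimplePeriodicOrbit Ω H v τ)
    (hX : ∀ p, ContDiffAt ℝ 1 (chartField (hamiltonianVectorField Ω H) p)
      (extChartAt (𝓡 4) p p)) :
    hamiltonianVectorField Ω H (v 0) ≠ 0 := by
  intro h0
  have h := isMIntegralCurve_Ioo_eq_of_contMDiff_boundaryless (t₀ := 0)
    (contMDiff_section_of_chartField hX) hv.isMIntegralCurve (isMIntegralCurve_const h0) (by simp)
  refine hv.apply_zero_ne_apply_half ?_
  have h2 := congrFun h (1 / 2 * τ)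
  simp only [mul_assoc, mul_inv_cancel₀ hv.period_pos.ne', mul_one] at h2
  exact h2.symm

theorem IsDoublySymmetricOrbit.exists_isReversibleRoot
    (hv : IsDoublySymmetricOrbit Ω H ρ₁ ρ₂ v τ)
    (hρ₁ : IsAntisymplecticInvolution Ω ρ₁) (hρ₂ : IsAntisymplecticInvolution Ω ρ₂)
    (hcomm : Function.Commute ρ₁ ρ₂) (hH : MDifferentiable (𝓡 4) 𝓘(ℝ, ℝ) H)
    (hX : ∀ p, ContDiffAt ℝ 1 (chartField (hamiltonianVectorField Ω H) p) (extChartAt (𝓡 4) p p))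
    (hH₁ : H ∘ ρ₁ = H) (hH₂ : H ∘ ρ₂ = H) :
    ∃ N R, IsReversibleRoot Ω H (v 0) (τ / 2) N R := by
  have hτ := hv.period_pos
  have hρ₁d : MDifferentiable (𝓡 4) (𝓡 4) ρ₁ := hρ₁.smooth.mdifferentiable (by simp)
  have hρ₂d : MDifferentiable (𝓡 4) (𝓡 4) ρ₂ := hρ₂.smooth.mdifferentiable (by simp)
  have hX₁ := hρ₁.mfderiv_hamiltonianVectorField hH hH₁
  have hX₂ := hρ₂.mfderiv_hamiltonianVectorField hH hH₂
  have hγ := hv.isMIntegralCurve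
  set γ : ℝ → M := fun s : ℝ => v ((s * τ⁻¹ : ℝ) : UnitAddCircle) with hγdef
  have hγ0 : γ 0 = v 0 := by simp [hγdef]
  have hperiod : ∀ s, γ (s + τ) = γ s := fun s => by
    simp only [hγdef, add_mul, mul_inv_cancel₀ hτ.ne', AddCircle.coe_add]
    rw [AddCircle.coe_period, add_zero]
  have hγ₁ : ∀ s, ρ₁ (γ s) = γ (-s) := fun s => by
    have h := hv.symmetric (((-s) * τ⁻¹ : ℝ) : UnitAddCircle)
    rwa [← AddCircle.coe_neg, neg_mul, neg_neg, ← neg_mul] at h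
  have hhalf : ρ₂ (γ 0) = γ (τ / 2) := by
    rw [hγ0, hv.half]
    simp only [hγdef]
    congr 2
    field_simp
  have hγ₂ : ∀ s, ρ₂ (γ s) = γ (τ / 2 + -s) := fun s => by
    have h1 := hγ.flowsTo s (-s)
    rw [add_neg_cancel] at h1
    have h2 := h1.map_of_neg hρ₂d hX₂
    rw [hhalf] at h2
    rw [← h2.flowMap_eq hX, (hγ.flowsTo (τ / 2) (-s)).flowMap_eq hX]
  rw [← hγ0]
  refine _root_.exists_isReversibleRoot (σ := ρ₁ ∘ ρ₂) hH hX hρ₁ hH₁ (hρ₁d.comp hρ₂d)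
    (fun x => ?_) ?_ (fun x => ?_) (fun t x y h => ?_)
    (by positivity) hγ (fun s => ?_) (by rw [hγ₁, neg_zero])
  · simp only [Function.comp_apply]
    rw [← hcomm.eq (ρ₂ x), hρ₂.involutive, hρ₁.involutive]
  · rw [← Function.comp_assoc, hH₁, hH₂]
  · simp only [Function.comp_apply]
    rw [hcomm.eq x]
  · have h2 := h.map_of_neg hρ₂d hX₂
    exact FlowsTo.map_of_neg (ρ := ρ₁) hρ₁d hX₁ h2
  · rw [Function.comp_apply, hγ₂, hγ₁, ← hperiod]
    congr 1
    ring

end DoublySymmetric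

theorem corollary4 {M : Type*} [TopologicalSpace M] [T2Space M] [ChartedSpace R4 M]
    [IsManifold (𝓡 4) ∞ M] (Ω : SymplecticForm M) (ρ₁ ρ₂ : M → M)
    (hρ₁ : IsAntisymplecticInvolution Ω ρ₁) (hρ₂ : IsAntisymplecticInvolution Ω ρ₂)
    (hne : ρ₁ ≠ ρ₂) (hcomm : Function.Commute ρ₁ ρ₂)
    (H : M → ℝ) (hH : ContMDiff (𝓡 4) 𝓘(ℝ, ℝ) ∞ H)
    (hH₁ : H ∘ ρ₁ = H) (hH₂ : H ∘ ρ₂ = H)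
    (v : UnitAddCircle → M) (τ : ℝ) (hv : IsDoublySymmetricOrbit Ω H ρ₁ ρ₂ v τ) :
    (∃! A : ReducedTangent Ω H (v 0) →ₗ[ℝ] ReducedTangent Ω H (v 0),
        IsReducedMonodromy Ω H v τ A) ∧
      ¬ IsNegativeHyperbolic Ω H v τ ∧
      ∀ k : ℕ, 0 < k → IsGoodOrbit Ω H (coverLoop k v) (k * τ) := by
  have : IsManifold (𝓡 4) 1 M := IsManifold.of_le (n := ∞) (by simp)
  have hX : ∀ p, ContDiffAt ℝ 1 (chartField (hamiltonianVectorField Ω H) p)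
      (extChartAt (𝓡 4) p p) := fun p =>
    contDiffAt_chartField_hamiltonian Ω hH p (mem_extChartAt_target p)
  obtain ⟨N, R, hNR⟩ := hv.exists_isReversibleRoot hρ₁ hρ₂ hcomm (hH.mdifferentiable (by simp))
    hX hH₁ hH₂
  have hX0 := hv.hamiltonianVectorField_ne_zero hX
  have hτ : 2 * (τ / 2) = τ := by ring
  refine ⟨by simpa only [hτ] using hNR.existsUnique_reducedMonodromy, ?_, fun k hk =>
    ⟨hv.isPeriodicOrbit_coverLoop hk, ?_⟩⟩
  · rintro ⟨A, hA, htr⟩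
    exact htr.not_ge (hNR.neg_two_le_trace hX0 1 rfl (by rwa [Nat.cast_one, one_mul, hτ]))
  · rintro ⟨w, σ, l, hl, -, -, ⟨A, hA, htr⟩, hcover, hperiod⟩
    obtain ⟨hw, m, rfl⟩ := hv.exists_period_eq_of_coverLoop_eq hl hcover hperiod
    exact htr.not_ge (hNR.neg_two_le_trace hX0 m hw (by rwa [hτ]))
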